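/- Let $\mathcal H,\mathcal K$ be separable complex Hilbert spaces, let $(|i\rangle)_{i\in\Lambda}$ be an orthonormal basis of $\mathcal K$, and put $\mathcal A=\mathcal B(\mathcal H\otimes\mathcal K)$. Let $B_j^i\in\mathcal B(\mathcal H)$ $(i,j\in\Lambda)$ satisfy $\sum_i B_j^{i*}B_j^i=1$ (strongly) for every $j$, and let $\rho_j\neq 0$ $(j\in\Lambda)$ be positive trace-class operators on $\mathcal H$ with $\sum_j\mathrm{Tr}(\rho_j)=1$. Put $$M_j^i=B_j^i\otimes|i\rangle\langle j|,\qquad A_j^i=\mathrm{Tr}(\rho_j)^{-1/2}\rho_j^{1/2}\otimes|i\rangle\langle j|.$$ Let $V$ be the vertex set of the rooted tree with root $o$ in which every vertex $u$ has exactly $k\ge 1$ direct successors $(u,1),\dots,(u,k)$. Let $W_n$, $\Lambda_n$ and $\Lambda_{[1,n]}$ be the sets of vertices at distance exactly $n$, at most $n$, and between $1$ and $n$ from $o$. Let $\mathcal A_V$ be the quasi-local C*-algebra of $V$ with the algebra $\mathcal A$ at every vertex, i.e. the infinite (spatial) C*-tensor product $\bigotimes_{u\in V}\mathcal A$. Let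 $\mathcal E$ be the transition expectation of the open quantum random walk, $$\mathcal E(a)=\mathrm{Tr}_{o]}(KaK^*),\qquad K=\sum_{i,j}M_j^{i*}\otimes A_j^i\otimes\cdots\otimes A_j^i\quad(k\text{ factors }A_j^i),$$ where $\mathrm{Tr}_{o]}$ is the partial trace over the $k$ successors of the root; or let $\mathcal E$ be its diagonal form $$\mathcal E(a_o\otimes a_1\otimes\cdots\otimes a_k)=\sum_{i,j}M_j^{i*}a_oM_j^i\prod_{\ell=1}^k\varphi_j(a_\ell),\qquad \varphi_j(b)=\frac{\mathrm{Tr}((\rho_j\otimes|j\rangle\langle j|)\,b)}{\mathrm{Tr}(\rho_j)}.$$ (The two differ as maps, but the assertions below hold for each of them.) Let $\mathcal E_u$ be the copy of $\mathcal E$ at the vertex $u$ and its successors, $\mathcal E_{W_n}=\bigotimes_{u\in W_n}\mathcal E_u$, and $E_{\Lambda_n}=\mathrm{id}_{\Lambda_{n-1}}\otimes\mathcal E_{W_n}$. For $j\in\Lambda$ and $a,b\in\mathcal A$ put $$\mathcal M_j(a)=\sum_i M_j^{i*}\,a\,M_j^i,\qquad \psi_j(b)=\frac1{\mathrm{Tr}(\rho_j)}\sum_i\mathrm{Tr}\big((B_j^i\rho_jB_j^{i*}\otimes|i\rangle\langle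 i|)\,b\big).$$ The first series converges strongly, the second absolutely. Then there is a unique bounded linear map $E_{o]}:\mathcal A_V\to\mathcal A$ (the conditional expectation associated with $\mathcal E$, with $\mathcal A_o$ identified with $\mathcal A$) such that $$E_{o]}(a)=\mathcal E_o\big(a_o\otimes\mathcal E_{W_1}(a_{W_1}\otimes\cdots\otimes\mathcal E_{W_n}(a_{W_n}\otimes 1))\big)$$ for all $n\ge 0$ and all $a=\bigotimes_{u\in\Lambda_n}a_u$, where $a_{W_m}=\bigotimes_{u\in W_m}a_u$. For all such $a$, $$E_{o]}(a)=\sum_{j\in\Lambda}\mathcal M_j(a_o)\prod_{u\in\Lambda_{[1,n]}}\psi_j(a_u)\qquad\text{(strong convergence)}.$$ Moreover, for every density operator $\omega_o$ on $\mathcal H\otimes\mathcal K$, with $\phi_o=\mathrm{Tr}(\omega_o\,\cdot\,)$, the quantum Markov chain $\varphi\equiv(\phi_o,\mathcal E)$ on $\mathcal A_V$ with trivial boundary condition, i.e. the state with $\varphi(a)=\lim_{n}\phi_o\circ E_{\Lambda_0}\circ\cdots\circ E_{\Lambda_n}(a)$ for all local product elements $a$, exists and is unique, it satisfies $\varphi=\phi_o\circ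 E_{o]}$, and for $a=\bigotimes_{u\in\Lambda_n}a_u$ $$\varphi(a)=\sum_{j\in\Lambda}\mathrm{Tr}\big(\omega_o\mathcal M_j(a_o)\big)\prod_{u\in\Lambda_{[1,n]}}\psi_j(a_u).$$ -/

import Mathlib

open Filter Topology
open scoped TensorProduct InnerProductSpace ComplexOrder ENNReal

noncomputable section

namespace TreeOQRW

/-! ### Hilbert spaces, traces, tensor products -/

/-- The bounded operators on `𝓗`. -/
abbrev Op (𝓗 : Type*) [NormedAddCommGroup 𝓗] [InnerProductSpace ℂ 𝓗] := 𝓗 →L[ℂ] 𝓗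

/-- The Hilbert space of square-summable families of complex numbers indexed by `X`. -/
abbrev L2 (X : Type*) := lp (fun _ : X => ℂ) 2

section Hilbert

variable (𝓗 : Type*) [NormedAddCommGroup 𝓗] [InnerProductSpace ℂ 𝓗] [CompleteSpace 𝓗]

/-- The index set of an orthonormal basis of `𝓗`, chosen once and for all. -/
def basisSet : Set 𝓗 := (exists_hilbertBasis ℂ 𝓗).choose

/-- An orthonormal basis of `𝓗`, chosen once and for all. -/
def stdBasis : HilbertBasis (basisSet 𝓗) ℂ 𝓗 := (exists_hilbertBasis ℂ 𝓗).choose_spec.choose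

/-- The Hilbert tensor product of copies of `𝓗` indexed by `X`, in the coordinates of the chosen
orthonormal basis `b`: the vector `⨂ b (s x)` is the basis vector indexed by `s`.  For finite `X`
this is the Hilbert tensor product.  For infinite `X` it is the (complete, von Neumann) infinite
tensor product restricted to product vectors of basis vectors; it is used only to represent the
operators that act on finitely many sites, and on those it is faithful. -/
abbrev HTensor (X : Type*) := L2 (X → basisSet 𝓗)

variable {𝓗}

/-- `Tr T = ∑ ⟨b_s, T b_s⟩`. -/
def trace (T : Op 𝓗) : ℂ := ∑' s, ⟪stdBasis 𝓗 s, T (stdBasis 𝓗 s)⟫_ℂ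

/-- A positive trace-class operator. -/
structure IsPosTraceClass (T : Op 𝓗) : Prop where
  pos : T.IsPositive
  summable : Summable fun s => ⟪stdBasis 𝓗 s, T (stdBasis 𝓗 s)⟫_ℂ

/-- A density operator: positive, trace class, of trace one. -/
structure IsDensity (T : Op 𝓗) : Prop where
  posTraceClass : IsPosTraceClass T
  trace_eq_one : trace T = 1

open Classical in
/-- The sum of a family of operators in the strong operator topology (`0` if it diverges). -/
def strongSum {J : Type*} (f : J → Op 𝓗) : Op 𝓗 :=
  if h : ∃ T : Op 𝓗, ∀ x, HasSum (fun j => f j x) (T x) then h.choose else 0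

variable {X : Type*}

open Classical in
theorem memℓp_slice {I : Type*} (x : X) (s : X → I) (f : L2 (X → I)) :
    Memℓp (fun r : I => f (Function.update s x r)) 2 := by
  have h2 : (0 : ℝ) < (2 : ℝ≥0∞).toReal := by norm_num
  rw [memℓp_gen_iff h2]
  exact ((memℓp_gen_iff h2).1 (lp.memℓp f)).comp_injective (Function.update_injective s x)

open Classical in
/-- The coordinates of `f` along the site `x`, the other sites being in the configuration `s`. -/
def slice {I : Type*} (x : X) (s : X → I) (f : L2 (X → I)) : L2 I :=
  ⟨fun r => f (Function.update s x r), memℓp_slice x s f⟩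

open Classical in
theorem sum_slice {I : Type*} (x : X) (A : Op (L2 I)) (f : L2 (X → I)) :
    Summable (fun s : X → I => ‖A (slice x s f) (s x)‖ ^ (2 : ℝ)) ∧
      ∑' s : X → I, ‖A (slice x s f) (s x)‖ ^ (2 : ℝ) ≤ (‖A‖ * ‖f‖) ^ (2 : ℝ) := by
  have h2 : (0 : ℝ) < (2 : ℝ≥0∞).toReal := by norm_num
  have hn : ∀ g : L2 I, HasSum (fun i => ‖g i‖ ^ (2 : ℝ)) (‖g‖ ^ (2 : ℝ)) := by
    intro g
    simpa using lp.hasSum_norm h2 g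
  have hnf : HasSum (fun s => ‖f s‖ ^ (2 : ℝ)) (‖f‖ ^ (2 : ℝ)) := by
    simpa using lp.hasSum_norm h2 f
  let e := (Equiv.funSplitAt x I).symm.trans (Equiv.refl (X → I))
  let e' : ({y // y ≠ x} → I) × I ≃ (X → I) := (Equiv.prodComm _ _).trans e
  have hev : ∀ p : ({y // y ≠ x} → I) × I, e' p x = p.2 := by
    intro p
    simp [e', e, Equiv.funSplitAt, Equiv.piSplitAt]
  have hup : ∀ (p : ({y // y ≠ x} → I) × I) (r : I),
      Function.update (e' p) x r = e' (p.1, r) := by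
    intro p r
    funext y
    by_cases hy : y = x
    · subst hy; simp [e', e, Equiv.funSplitAt, Equiv.piSplitAt]
    · simp [e', e, Equiv.funSplitAt, Equiv.piSplitAt, hy]
  by_cases hI : IsEmpty I
  · have hX : IsEmpty (X → I) := ⟨fun s => hI.elim (s x)⟩
    refine ⟨summable_empty, ?_⟩
    rw [tsum_empty]; positivity
  rw [not_isEmpty_iff] at hI
  obtain ⟨r₀⟩ := hI
  -- the slice depends only on the configuration away from `x`
  let g : ({y // y ≠ x} → I) → L2 I := fun q => slice x (e' (q, r₀)) f
  have hg : ∀ p, slice x (e' p) f = g p.1 := by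
    intro p
    apply lp.ext
    funext r
    change f (Function.update (e' p) x r) = f (Function.update (e' (p.1, r₀)) x r)
    rw [hup, hup]
  have hgr : ∀ q r, g q r = f (e' (q, r)) := by
    intro q r
    change f (Function.update (e' (q, r₀)) x r) = _
    rw [hup]
  have hf : HasSum (fun p => ‖f (e' p)‖ ^ (2 : ℝ)) (‖f‖ ^ (2 : ℝ)) :=
    e'.hasSum_iff.2 hnf
  have hf' : HasSum (fun q => ‖g q‖ ^ (2 : ℝ)) (‖f‖ ^ (2 : ℝ)) := by
    refine hf.prod_fiberwise fun q => ?_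
    have := hn (g q)
    simp only [hgr] at this
    exact this
  have hle : ∀ q, ‖A (g q)‖ ^ (2 : ℝ) ≤ ‖A‖ ^ (2 : ℝ) * ‖g q‖ ^ (2 : ℝ) := by
    intro q
    rw [← Real.mul_rpow (norm_nonneg _) (norm_nonneg _)]
    exact Real.rpow_le_rpow (norm_nonneg _) (A.le_opNorm _) (by norm_num)
  have hsA : Summable fun q => ‖A (g q)‖ ^ (2 : ℝ) :=
    Summable.of_nonneg_of_le (fun q => by positivity) hle (hf'.summable.mul_left _)
  have hs : Summable fun p : ({y // y ≠ x} → I) × I => ‖A (g p.1) p.2‖ ^ (2 : ℝ) := by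
    rw [summable_prod_of_nonneg (fun p => by positivity)]
    refine ⟨fun q => (hn (A (g q))).summable, ?_⟩
    simpa only [fun q => (hn (A (g q))).tsum_eq] using hsA
  have hcongr : ∀ p, ‖A (slice x (e' p) f) (e' p x)‖ ^ (2 : ℝ) = ‖A (g p.1) p.2‖ ^ (2 : ℝ) := by
    intro p; rw [hg, hev]
  have hs' : Summable fun s : X → I => ‖A (slice x s f) (s x)‖ ^ (2 : ℝ) := by
    rw [← e'.summable_iff]
    exact hs.congr fun p => (hcongr p).symm
  refine ⟨hs', ?_⟩
  have h3 : ∑' q, ∑' r, ‖A (g q) r‖ ^ (2 : ℝ) = ∑' q, ‖A (g q)‖ ^ (2 : ℝ) :=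
    tsum_congr fun q => (hn (A (g q))).tsum_eq
  rw [← e'.tsum_eq, tsum_congr hcongr, hs.tsum_prod, h3, Real.mul_rpow (norm_nonneg _) (norm_nonneg _),
    ← hf'.tsum_eq, ← tsum_mul_left]
  exact Summable.tsum_le_tsum hle hsA (hf'.summable.mul_left _)

/-- The operator `A` on `L2 I` in coordinates, made to act on the site `x`. -/
def siteOpCoord {I : Type*} (x : X) (A : Op (L2 I)) : Op (L2 (X → I)) :=
  LinearMap.mkContinuous
    { toFun := fun f => ⟨fun s => A (slice x s f) (s x), by
        refine (memℓp_gen_iff (by norm_num : (0 : ℝ) < (2 : ℝ≥0∞).toReal)).2 ?_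
        simpa using (sum_slice x A f).1⟩
      map_add' := by
        intro f g
        apply lp.ext
        funext s
        have : slice x s (f + g) = slice x s f + slice x s g := by
          apply lp.ext; funext r; rfl
        change A (slice x s (f + g)) (s x) = A (slice x s f) (s x) + A (slice x s g) (s x)
        rw [this, map_add]; rfl
      map_smul' := by
        intro c f
        apply lp.ext
        funext s
        have : slice x s (c • f) = c • slice x s f := by
          apply lp.ext; funext r; rfl
        change A (slice x s (c • f)) (s x) = c • A (slice x s f) (s x)
        rw [this, map_smul]; rfl } ‖A‖ (by
    intro f
    refine lp.norm_le_of_tsum_le (by norm_num : (0 : ℝ) < (2 : ℝ≥0∞).toReal) (by positivity) ?_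
    simpa using (sum_slice x A f).2)

/-- The observable `a` placed at the site `x`: `a ⊗ 1 ⊗ 1 ⊗ ⋯` with `a` in the factor `x`. -/
def siteOp (x : X) (a : Op 𝓗) : Op (HTensor 𝓗 X) :=
  siteOpCoord x
    ((stdBasis 𝓗).repr.toContinuousLinearEquiv.toContinuousLinearMap ∘L a ∘L
      (stdBasis 𝓗).repr.symm.toContinuousLinearEquiv.toContinuousLinearMap)

/-- The product element `⨂_{x ∈ F} a x` (identity at the other sites), as the product of the
operators `siteOp x (a x)`, `x ∈ F`.  These commute, so the order of the product is irrelevant. -/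
def productOp (F : Finset X) (a : X → Op 𝓗) : Op (HTensor 𝓗 X) :=
  (F.toList.map fun x => siteOp x (a x)).prod

variable (𝓗 X) in
/-- The quasi-local C*-algebra over the set of sites `X`: the norm closure of the *-algebra
generated by the one-site observables. -/
def quasiLocal : StarSubalgebra ℂ (Op (HTensor 𝓗 X)) :=
  (StarAlgebra.adjoin ℂ {T | ∃ (x : X) (a : Op 𝓗), T = siteOp x a}).topologicalClosure

theorem productOp_mem (F : Finset X) (a : X → Op 𝓗) : productOp F a ∈ quasiLocal 𝓗 X := by
  refine list_prod_mem fun T hT => ?_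
  obtain ⟨x, -, rfl⟩ := List.mem_map.1 hT
  exact StarSubalgebra.le_topologicalClosure _ (StarAlgebra.subset_adjoin ℂ _ ⟨x, a x, rfl⟩)

/-- The product element `⨂_{x ∈ F} a x` in the quasi-local algebra. -/
def productElt (F : Finset X) (a : X → Op 𝓗) : quasiLocal 𝓗 X := ⟨productOp F a, productOp_mem F a⟩

/-- A state on the quasi-local algebra. -/
structure IsState (φ : quasiLocal 𝓗 X →L[ℂ] ℂ) : Prop where
  map_one : φ 1 = 1
  nonneg : ∀ a, 0 ≤ φ (star a * a)

open Classical in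
/-- The vector `⨂ b (s x)` of the product basis. -/
def basisVec (s : X → basisSet 𝓗) : HTensor 𝓗 X := lp.single 2 s (1 : ℂ)

open Classical in
/-- The partial trace over the sites `some ℓ`, with values in the operators of the site `none`:
`⟨b_s, Tr(Y) b_t⟩ = ∑_r ⟨b_s ⊗ b_r, Y (b_t ⊗ b_r)⟩` (and `0` if no bounded operator has these
matrix entries). -/
def partialTrace {k : ℕ} (Y : Op (HTensor 𝓗 (Option (Fin k)))) : Op 𝓗 :=
  if h : ∃ T : Op 𝓗, ∀ s t : basisSet 𝓗,
      HasSum (fun r : Fin k → basisSet 𝓗 =>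
        ⟪basisVec (fun o : Option (Fin k) => o.elim s r),
          Y (basisVec (fun o : Option (Fin k) => o.elim t r))⟫_ℂ)
        ⟪stdBasis 𝓗 s, T (stdBasis 𝓗 t)⟫_ℂ
  then h.choose else 0

end Hilbert

/-! ### The Cayley tree -/

section Tree

/-- The vertices of the rooted tree in which every vertex has `k` direct successors: the root is
`[]`, and the direct successors of `u` are `u ++ [ℓ]`, `ℓ ∈ Fin k`.  The distance of `u` to the
root is its length. -/
abbrev Vertex (k : ℕ) := List (Fin k)

/-- `Λ_n`, the vertices at distance at most `n` from the root. -/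
def ball (k n : ℕ) : Finset (Vertex k) :=
  (List.finite_length_le (Fin k) n).toFinset

/-- `Λ_{[1,n]}`, the vertices at distance between `1` and `n` from the root. -/
def annulus (k n : ℕ) : Finset (Vertex k) := (ball k n).filter fun u => 1 ≤ u.length

variable {𝓗 : Type*} [NormedAddCommGroup 𝓗] [InnerProductSpace ℂ 𝓗] [CompleteSpace 𝓗] {k : ℕ}

/-- The family of one-site observables that stands for `⨂_{u ∈ Λ_n} a u` in the larger volumes. -/
def pad (n : ℕ) (a : Vertex k → Op 𝓗) : Vertex k → Op 𝓗 :=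
  fun u => if u.length ≤ n then a u else 1

/-- The map `E_{Λ_n} = id_{Λ_{n-1}} ⊗ ⨂_{u ∈ W_n} 𝓔_u` from the observables of `Λ_{n+1}` to those
of `Λ_n`, on product elements.  Here every `𝓔_u` is the copy at `u` of one and the same transition
expectation `𝓔`, given by its values `𝓔 a c` on `a ⊗ c 1 ⊗ ⋯ ⊗ c k`. -/
def levelExp (𝓔 : Op 𝓗 → (Fin k → Op 𝓗) → Op 𝓗) (n : ℕ) (a : Vertex k → Op 𝓗) :
    Vertex k → Op 𝓗 :=
  fun u => if u.length < n then a u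
    else if u.length = n then 𝓔 (a u) fun ℓ => a (u ++ [ℓ]) else 1

/-- `E_{Λ_0} ∘ E_{Λ_1} ∘ ⋯ ∘ E_{Λ_n}` on product elements of `Λ_{n+1}`, with values in the
observables of the root. -/
def iterExp (𝓔 : Op 𝓗 → (Fin k → Op 𝓗) → Op 𝓗) : ℕ → (Vertex k → Op 𝓗) → Op 𝓗
  | 0, a => levelExp 𝓔 0 a []
  | n + 1, a => iterExp 𝓔 n (levelExp 𝓔 (n + 1) a)

/-- `E` is the conditional expectation onto the root associated with `𝓔`:
`E (a_o ⊗ a_{W_1} ⊗ ⋯ ⊗ a_{W_n}) = 𝓔_o (a_o ⊗ 𝓔_{W_1} (a_{W_1} ⊗ ⋯ 𝓔_{W_n} (a_{W_n} ⊗ 1)))`. -/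
def IsRootExpectation (𝓔 : Op 𝓗 → (Fin k → Op 𝓗) → Op 𝓗)
    (E : quasiLocal 𝓗 (Vertex k) →L[ℂ] Op 𝓗) : Prop :=
  ∀ (n : ℕ) (a : Vertex k → Op 𝓗), E (productElt (ball k n) a) = iterExp 𝓔 n (pad n a)

/-- `φ` is the quantum Markov chain `(φ_o, 𝓔)` with trivial boundary condition: a state such that
`φ a = lim φ_o (E_{Λ_0} ∘ ⋯ ∘ E_{Λ_n} (a))` for every local product element `a`. -/
structure IsQMC (φ₀ : Op 𝓗 → ℂ) (𝓔 : Op 𝓗 → (Fin k → Op 𝓗) → Op 𝓗)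
    (φ : quasiLocal 𝓗 (Vertex k) →L[ℂ] ℂ) : Prop where
  isState : IsState φ
  tendsto : ∀ (m : ℕ) (a : Vertex k → Op 𝓗),
    Tendsto (fun n => φ₀ (iterExp 𝓔 n (pad m a))) atTop (𝓝 (φ (productElt (ball k m) a)))

end Tree

/-! ### Open quantum random walks -/

section Walk

variable {H K Λ : Type*} [NormedAddCommGroup H] [InnerProductSpace ℂ H] [CompleteSpace H]
  [NormedAddCommGroup K] [InnerProductSpace ℂ K]

variable (H K) in
/-- The Hilbert tensor product `H ⊗ K`. -/
abbrev HK := UniformSpace.Completion (H ⊗[ℂ] K)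

/-- The operator `S ⊗ T` on the Hilbert space `H ⊗ K`. -/
def opTensor (S : Op H) (T : Op K) : Op (HK H K) :=
  ((UniformSpace.Completion.toComplL : (H ⊗[ℂ] K) →L[ℂ] HK H K) ∘L
    TensorProduct.mapL S T).extend UniformSpace.Completion.toComplL

variable (H Λ) in
/-- The data of an open quantum random walk: the effects `B i j` of the passage from `j` to `i`
(written `B_j^i`), and the blocks `ρ j` of an initial density operator `∑ ρ_j ⊗ |j⟩⟨j|`. -/
structure OQRW where
  B : Λ → Λ → Op H
  sum_B : ∀ j x, HasSum (fun i => (B i j).adjoint (B i j x)) x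
  ρ : Λ → Op H
  ρ_posTraceClass : ∀ j, IsPosTraceClass (ρ j)
  ρ_ne_zero : ∀ j, ρ j ≠ 0
  sum_ρ : HasSum (fun j => trace (ρ j)) 1

namespace OQRW

variable (W : OQRW H Λ) (e : HilbertBasis Λ ℂ K) (k : ℕ)

/-- `|i⟩⟨j|`. -/
def ketBra (i j : Λ) : Op K := InnerProductSpace.rankOne ℂ (e i) (e j)

/-- `M_j^i = B_j^i ⊗ |i⟩⟨j|`. -/
def M (i j : Λ) : Op (HK H K) := opTensor (W.B i j) (ketBra e i j)

/-- `A_j^i = Tr(ρ_j)^{-1/2} ρ_j^{1/2} ⊗ |i⟩⟨j|`. -/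
def A (i j : Λ) : Op (HK H K) :=
  (((Real.sqrt (trace (W.ρ j)).re)⁻¹ : ℝ) : ℂ) • opTensor (CFC.sqrt (W.ρ j)) (ketBra e i j)

/-- `K_j^i = M_j^{i*} ⊗ A_j^i ⊗ ⋯ ⊗ A_j^i`, on a vertex (`none`) and its `k` direct successors
(`some ℓ`). -/
def kraus (i j : Λ) : Op (HTensor (HK H K) (Option (Fin k))) :=
  productOp Finset.univ fun o => o.elim (W.M e i j).adjoint fun _ => W.A e i j

/-- `K = ∑_{i,j} K_j^i`. -/
def totalKraus : Op (HTensor (HK H K) (Option (Fin k))) :=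
  strongSum fun p : Λ × Λ => W.kraus e k p.1 p.2

/-- The transition expectation `𝓔(Y) = Tr_{u]}(K Y K*)`. -/
def transitionExp (Y : Op (HTensor (HK H K) (Option (Fin k)))) : Op (HK H K) :=
  partialTrace (W.totalKraus e k * Y * (W.totalKraus e k).adjoint)

/-- `𝓔(a ⊗ c_1 ⊗ ⋯ ⊗ c_k)`, for `𝓔(Y) = Tr_{u]}(K Y K*)`. -/
def prodTransitionExp (a : Op (HK H K)) (c : Fin k → Op (HK H K)) : Op (HK H K) :=
  W.transitionExp e k (productOp Finset.univ fun o => o.elim a c)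

/-- `φ_j(b) = Tr(ρ_j)⁻¹ Tr((ρ_j ⊗ |j⟩⟨j|) b)`. -/
def stateφ (j : Λ) (b : Op (HK H K)) : ℂ :=
  (trace (W.ρ j))⁻¹ * trace (opTensor (W.ρ j) (ketBra e j j) * b)

/-- The diagonal transition expectation
`𝓔(a ⊗ c_1 ⊗ ⋯ ⊗ c_k) = ∑_{i,j} M_j^{i*} a M_j^i ∏_ℓ φ_j(c_ℓ)`. -/
def diagTransitionExp (a : Op (HK H K)) (c : Fin k → Op (HK H K)) : Op (HK H K) :=
  strongSum fun p : Λ × Λ =>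
    (∏ ℓ, W.stateφ e p.2 (c ℓ)) • ((W.M e p.1 p.2).adjoint * a * W.M e p.1 p.2)

/-- `𝓜_j(a) = ∑_i M_j^{i*} a M_j^i`. -/
def calM (j : Λ) (a : Op (HK H K)) : Op (HK H K) :=
  strongSum fun i => (W.M e i j).adjoint * a * W.M e i j

/-- `ψ_j(b) = Tr(ρ_j)⁻¹ ∑_i Tr((B_j^i ρ_j B_j^{i*} ⊗ |i⟩⟨i|) b)`. -/
def ψ (j : Λ) (b : Op (HK H K)) : ℂ :=
  (trace (W.ρ j))⁻¹ *
    ∑' i, trace (opTensor (W.B i j * W.ρ j * (W.B i j).adjoint) (ketBra e i i) * b)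

end OQRW

end Walk

end TreeOQRW

end

open TreeOQRW

open Filter Topology
open scoped TensorProduct InnerProductSpace ComplexOrder ENNReal

noncomputable section

set_option linter.unusedSectionVars false

namespace TreeOQRW

/-! The operator M_j^i kills every block H ⊗ |l⟩ with l ≠ j and maps H ⊗ |j⟩ into H ⊗ |i⟩. Hence
𝓜_j(a) lives on block j alone, and ∑_j c_j 𝓜_j(a) (`weighted`) is block diagonal. The state φ_j sees
only block j and satisfies φ_j ∘ 𝓜_j = ψ_j, so it sends this sum to c_j ψ_j(a) (`stateφ_weighted`).
The diagonal transition expectation has the weights c_j = ∏ φ_j(c_ℓ). Each level of the iteration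
therefore turns its observables into factors ψ_j(a_u), with one index j inherited through the whole
tree, and the identities further out contribute φ_j(1) = ψ_j(1) = 1 (`iterExp_eq`, `iterExp_pad`).

For the form Tr(K · K*), the cross terms contain the traces of A_j^i c A_{j'}^{i'*}. For block
diagonal c such a trace is φ_j(c) when (i,j) = (i',j') and 0 otherwise (`hasSum_inner_A`); a single
successor is enough to remove a cross term. So both expectations agree when the successors carry
block diagonal operators (`prodTransitionExp_eq`). The iteration meets no others: it starts from
identities, and its values are block diagonal.

The formula on product elements must still be extended continuously. In each finite volume it is
realised by a Kraus-type positive contraction on all bounded operators (`exists_finiteVolumeExp`),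
because ψ_j is a sum of vector functionals of total weight one. These maps are consistent since
ψ_j(1) = 1, hence eventually constant on local product elements, and contractivity gives a limit on
the norm closure (`hasRootMap`). Positivity survives the limit, so a density operator at the root
yields a state; uniqueness is density of the local products (`quasiLocal_ext`).

Convergence rests on `exists_hasSum_sandwich`, strong summability of R_m* T_m D_m for Bessel
families R, D and bounded T, and on writing traces against ρ as sums over the vectors √ρ b_s. -/

theorem hasSum_prod_of_nonneg {α β : Type*} {f : α × β → ℝ} (hf : ∀ p, 0 ≤ f p) {g : α → ℝ}
    (h1 : ∀ a, HasSum (fun b => f (a, b)) (g a)) {c : ℝ} (h2 : HasSum g c) : HasSum f c := by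
  have hs : Summable f := by
    rw [summable_prod_of_nonneg hf]
    refine ⟨fun a => (h1 a).summable, ?_⟩
    simpa only [(h1 _).tsum_eq] using h2.summable
  have := hs.hasSum.prod_fiberwise h1
  rw [← this.unique h2]
  exact hs.hasSum

/-! ### Bessel families and strongly convergent Kraus sums -/

section Bessel

variable {ι G G' G'' : Type*} [NormedAddCommGroup G] [InnerProductSpace ℂ G] [CompleteSpace G]
  [NormedAddCommGroup G'] [InnerProductSpace ℂ G'] [CompleteSpace G']
  [NormedAddCommGroup G''] [InnerProductSpace ℂ G''] [CompleteSpace G'']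

/-- A family of operators with `∑ ‖K m x‖² ≤ ‖x‖²` for every `x`. -/
def IsBessel (K : ι → G →L[ℂ] G') : Prop :=
  ∀ (x : G) (s : Finset ι), ∑ m ∈ s, ‖K m x‖ ^ 2 ≤ ‖x‖ ^ 2

theorem IsBessel.summable {K : ι → G →L[ℂ] G'} (hK : IsBessel K) (x : G) :
    Summable fun m => ‖K m x‖ ^ 2 :=
  summable_of_sum_le (fun _ => by positivity) (hK x)

theorem isBessel_of_hasSum {K : ι → G →L[ℂ] G'}
    (h : ∀ x, HasSum (fun m => ‖K m x‖ ^ 2) (‖x‖ ^ 2)) : IsBessel K :=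
  fun x s => sum_le_hasSum s (fun _ _ => by positivity) (h x)

/-- Pair the sum v with itself, move each R_m onto v, and apply Cauchy-Schwarz in the space and then
over the index. The Bessel bound turns the R-part into ‖v‖, which cancels. -/
theorem norm_sum_sandwich_le {R : ι → G'' →L[ℂ] G'} {D : ι → G →L[ℂ] G'} (hR : IsBessel R)
    {T : ι → Op G'} {C : ℝ} (hC : ∀ m, ‖T m‖ ≤ C) (hC0 : 0 ≤ C) (x : G) (s : Finset ι) :
    ‖∑ m ∈ s, (R m).adjoint (T m (D m x))‖ ≤ C * √(∑ m ∈ s, ‖D m x‖ ^ 2) := by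
  set v := ∑ m ∈ s, (R m).adjoint (T m (D m x)) with hv
  have key : ‖v‖ * ‖v‖ ≤ ‖v‖ * (C * √(∑ m ∈ s, ‖D m x‖ ^ 2)) := by
    have h1 : ⟪v, v⟫_ℂ = ∑ m ∈ s, ⟪R m v, T m (D m x)⟫_ℂ := by
      conv_lhs => rw [hv, inner_sum]
      simp only [ContinuousLinearMap.adjoint_inner_right]
      rfl
    have h2 : ‖v‖ * ‖v‖ = ‖⟪v, v⟫_ℂ‖ := by
      rw [inner_self_eq_norm_sq_to_K]; simp [sq]
    rw [h2, h1]
    calc ‖∑ m ∈ s, ⟪R m v, T m (D m x)⟫_ℂ‖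
        ≤ ∑ m ∈ s, ‖⟪R m v, T m (D m x)⟫_ℂ‖ := norm_sum_le _ _
      _ ≤ ∑ m ∈ s, C * (‖R m v‖ * ‖D m x‖) := by
          refine Finset.sum_le_sum fun m _ => (norm_inner_le_norm _ _).trans ?_
          have := (T m).le_of_opNorm_le (hC m) (D m x)
          nlinarith [norm_nonneg (R m v)]
      _ = C * ∑ m ∈ s, ‖R m v‖ * ‖D m x‖ := by rw [Finset.mul_sum]
      _ ≤ C * (√(∑ m ∈ s, ‖R m v‖ ^ 2) * √(∑ m ∈ s, ‖D m x‖ ^ 2)) := by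
          gcongr; exact Real.sum_mul_le_sqrt_mul_sqrt _ _ _
      _ ≤ C * (‖v‖ * √(∑ m ∈ s, ‖D m x‖ ^ 2)) := by
          gcongr
          exact Real.sqrt_le_iff.2 ⟨norm_nonneg _, hR v s⟩
      _ = _ := by ring
  rcases (norm_nonneg v).eq_or_lt with h | h
  · rw [← h]; positivity
  · exact le_of_mul_le_mul_left key h

/-- Only the D-part of the preceding estimate has to become small: its tails do, since ∑ ‖D_m x‖²
converges. R needs only to be bounded as a family. -/
theorem exists_hasSum_sandwich {R : ι → G'' →L[ℂ] G'} {D : ι → G →L[ℂ] G'} (hR : IsBessel R)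
    (hD : IsBessel D) {T : ι → Op G'} {C : ℝ} (hC : ∀ m, ‖T m‖ ≤ C) (hC0 : 0 ≤ C) :
    ∃ S : G →L[ℂ] G'', ‖S‖ ≤ C ∧ ∀ x, HasSum (fun m => (R m).adjoint (T m (D m x))) (S x) := by
  have hs : ∀ x, Summable fun m => (R m).adjoint (T m (D m x)) := by
    intro x
    rw [summable_iff_vanishing_norm]
    intro ε hε
    -- C may vanish, so the tail is measured against C + 1.
    obtain ⟨s, hs⟩ := summable_iff_vanishing_norm.1 (hD.summable x) ((ε / (C + 1)) ^ 2)
      (by positivity)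
    refine ⟨s, fun t ht => (norm_sum_sandwich_le hR hC hC0 x t).trans_lt ?_⟩
    have h1 := hs t ht
    rw [Real.norm_of_nonneg (by positivity)] at h1
    have h2 : √(∑ m ∈ t, ‖D m x‖ ^ 2) < ε / (C + 1) := by
      rw [Real.sqrt_lt' (by positivity)]; exact h1
    calc C * √(∑ m ∈ t, ‖D m x‖ ^ 2) ≤ C * (ε / (C + 1)) := by gcongr
      _ < ε := by
        rw [← mul_div_assoc, div_lt_iff₀ (by positivity)]; nlinarith
  refine ⟨LinearMap.mkContinuous
    { toFun := fun x => ∑' m, (R m).adjoint (T m (D m x))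
      map_add' := fun x y => by
        simp only [map_add]; exact (hs x).tsum_add (hs y)
      map_smul' := fun c x => by
        simp only [map_smul, RingHom.id_apply]; exact (hs x).tsum_const_smul c } C ?_,
    LinearMap.mkContinuous_norm_le _ hC0 _, fun x => (hs x).hasSum⟩
  intro x
  refine le_of_tendsto (hs x).hasSum.norm (Eventually.of_forall fun s => ?_)
  refine (norm_sum_sandwich_le hR hC hC0 x s).trans ?_
  gcongr
  exact Real.sqrt_le_iff.2 ⟨norm_nonneg _, hD x s⟩

theorem strongSum_hasSum {f : ι → Op G} (h : ∃ T : Op G, ∀ x, HasSum (fun j => f j x) (T x))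
    (x : G) : HasSum (fun j => f j x) (strongSum f x) := by
  rw [strongSum, dif_pos h]
  exact h.choose_spec x

theorem strongSum_eq {f : ι → Op G} {T : Op G} (h : ∀ x, HasSum (fun j => f j x) (T x)) :
    strongSum f = T :=
  ContinuousLinearMap.ext fun x => (strongSum_hasSum ⟨T, h⟩ x).unique (h x)

theorem IsBessel.hasSum_strongSum {K : ι → Op G} (hK : IsBessel K) {T : ι → Op G} {C : ℝ}
    (hC : ∀ m, ‖T m‖ ≤ C) (hC0 : 0 ≤ C) (x : G) :
    HasSum (fun m => (K m).adjoint (T m (K m x)))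
      (strongSum (fun m => (K m).adjoint * T m * K m) x) := by
  obtain ⟨S, -, hS⟩ := exists_hasSum_sandwich hK hK hC hC0
  exact strongSum_hasSum (f := fun m => (K m).adjoint * T m * K m) ⟨S, hS⟩ x

theorem IsBessel.norm_strongSum_le {K : ι → Op G} (hK : IsBessel K) {T : ι → Op G} {C : ℝ}
    (hC : ∀ m, ‖T m‖ ≤ C) (hC0 : 0 ≤ C) :
    ‖strongSum fun m => (K m).adjoint * T m * K m‖ ≤ C := by
  obtain ⟨S, h, hS⟩ := exists_hasSum_sandwich hK hK hC hC0
  rwa [strongSum_eq (f := fun m => (K m).adjoint * T m * K m) hS]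

/-- A positive contraction between algebras of operators. -/
structure IsPosContraction (Φ : Op G →L[ℂ] Op G') : Prop where
  norm_le : ∀ T, ‖Φ T‖ ≤ ‖T‖
  pos : ∀ T : Op G, T.IsPositive → (Φ T).IsPositive

theorem IsPosContraction.comp {Φ : Op G' →L[ℂ] Op G''} {Ψ : Op G →L[ℂ] Op G'}
    (hΦ : IsPosContraction Φ) (hΨ : IsPosContraction Ψ) : IsPosContraction (Φ ∘L Ψ) :=
  ⟨fun T => (hΦ.norm_le _).trans (hΨ.norm_le T), fun T hT => hΦ.pos _ (hΨ.pos T hT)⟩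

theorem isPosContraction_id : IsPosContraction (ContinuousLinearMap.id ℂ (Op G)) :=
  ⟨fun _ => le_rfl, fun _ h => h⟩

theorem isPositive_of_inner_nonneg {T : Op G} (h : ∀ x, 0 ≤ ⟪x, T x⟫_ℂ) : T.IsPositive := by
  rw [ContinuousLinearMap.isPositive_iff_complex]
  intro x
  have h1 := h x
  have h2 : ⟪T x, x⟫_ℂ = ⟪x, T x⟫_ℂ := by
    rw [← inner_conj_symm]; exact Complex.conj_eq_iff_im.2 (Complex.le_def.1 h1).2.symm
  rw [h2]
  exact ⟨Complex.ext rfl (Complex.le_def.1 h1).2, (Complex.le_def.1 h1).1⟩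

theorem inner_nonneg_of_isPositive {T : Op G} (h : T.IsPositive) (x : G) : 0 ≤ ⟪x, T x⟫_ℂ :=
  h.inner_nonneg_right x

/-- The inner map Θ may depend on the index m: later it evaluates the states ψ_j at the non-root
sites, and these depend on j. Linearity comes from uniqueness of strong limits, positivity from the
termwise quadratic form. -/
theorem exists_krausMap {K : ι → G →L[ℂ] G'} (hK : IsBessel K) {Θ : ι → Op G'' →L[ℂ] Op G'}
    (hΘ : ∀ m, IsPosContraction (Θ m)) :
    ∃ Φ : Op G'' →L[ℂ] Op G, IsPosContraction Φ ∧
      ∀ T x, HasSum (fun m => (K m).adjoint (Θ m T (K m x))) (Φ T x) := by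
  have h : ∀ T : Op G'', ∃ S : Op G, ‖S‖ ≤ ‖T‖ ∧
      ∀ x, HasSum (fun m => (K m).adjoint (Θ m T (K m x))) (S x) := fun T =>
    exists_hasSum_sandwich hK hK (fun m => (hΘ m).norm_le T) (norm_nonneg T)
  choose S hS1 hS2 using h
  refine ⟨LinearMap.mkContinuous
    { toFun := S
      map_add' := fun T T' => ContinuousLinearMap.ext fun x =>
        (hS2 (T + T') x).unique (by simpa using (hS2 T x).add (hS2 T' x))
      map_smul' := fun c T => ContinuousLinearMap.ext fun x =>
        (hS2 (c • T) x).unique (by simpa using (hS2 T x).const_smul c) } 1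
    (fun T => by simpa using hS1 T), ⟨hS1, fun T hT => ?_⟩, hS2⟩
  refine isPositive_of_inner_nonneg fun x => ?_
  have h1 : HasSum (fun m => ⟪K m x, Θ m T (K m x)⟫_ℂ) ⟪x, S T x⟫_ℂ := by
    simpa [ContinuousLinearMap.adjoint_inner_right] using
      (hS2 T x).mapL (innerSL ℂ x)
  exact h1.nonneg fun m => inner_nonneg_of_isPositive ((hΘ m).pos T hT) _

end Bessel

/-! ### Hilbert-Schmidt operators and traces through square roots -/

section HilbertSchmidt

variable {ι ι' G G' G'' : Type*} [NormedAddCommGroup G] [InnerProductSpace ℂ G] [CompleteSpace G]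
  [NormedAddCommGroup G'] [InnerProductSpace ℂ G'] [CompleteSpace G']
  [NormedAddCommGroup G''] [InnerProductSpace ℂ G''] [CompleteSpace G'']

theorem hasSum_norm_sq_inner (b : HilbertBasis ι ℂ G) (x : G) :
    HasSum (fun i => ‖⟪b i, x⟫_ℂ‖ ^ 2) (‖x‖ ^ 2) := by
  have := lp.hasSum_norm (by norm_num : (0 : ℝ) < (2 : ℝ≥0∞).toReal) (b.repr x)
  simpa [HilbertBasis.repr_apply_apply] using this

/-- A Hilbert-Schmidt operator. -/
def IsHS (S : G →L[ℂ] G') : Prop := Summable fun s => ‖S (stdBasis G s)‖ ^ 2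

theorem IsHS.summable_prod {S : G →L[ℂ] G'} (hS : IsHS S) :
    Summable fun p : basisSet G × basisSet G' =>
      ‖⟪stdBasis G' p.2, S (stdBasis G p.1)⟫_ℂ‖ ^ 2 := by
  exact (hasSum_prod_of_nonneg (fun _ => by positivity)
    (fun s => hasSum_norm_sq_inner (stdBasis G') (S (stdBasis G s))) (Summable.hasSum hS)).summable

/-- The squared moduli of the matrix entries form a summable double family, which is symmetric under
exchange of rows and columns. -/
theorem IsHS.adjoint {S : G →L[ℂ] G'} (hS : IsHS S) : IsHS S.adjoint := by
  have h : Summable fun t => ∑' s, ‖⟪stdBasis G' t, S (stdBasis G s)⟫_ℂ‖ ^ 2 :=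
    Summable.prod (f := fun q : basisSet G' × basisSet G =>
      ‖⟪stdBasis G' q.1, S (stdBasis G q.2)⟫_ℂ‖ ^ 2) hS.summable_prod.prod_symm
  refine Summable.congr h fun t => ?_
  have h1 := (hasSum_norm_sq_inner (stdBasis G) (S.adjoint (stdBasis G' t))).tsum_eq
  refine Eq.trans (tsum_congr fun s => ?_) h1
  rw [ContinuousLinearMap.adjoint_inner_right, norm_inner_symm]

theorem IsHS.comp_left {S : G →L[ℂ] G'} (hS : IsHS S) (T : G' →L[ℂ] G'') : IsHS (T ∘L S) := by
  refine Summable.of_nonneg_of_le (fun s => by positivity) (fun s => ?_)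
    (Summable.mul_left (‖T‖ ^ 2) hS)
  rw [← mul_pow]
  exact pow_le_pow_left₀ (norm_nonneg _) (T.le_opNorm _) 2

theorem IsHS.comp_right {S : G' →L[ℂ] G''} (hS : IsHS S) (T : G →L[ℂ] G') : IsHS (S ∘L T) := by
  have := (hS.adjoint.comp_left T.adjoint).adjoint
  rwa [ContinuousLinearMap.adjoint_comp, ContinuousLinearMap.adjoint_adjoint,
    ContinuousLinearMap.adjoint_adjoint] at this

theorem IsHS.summable_inner {R S : G →L[ℂ] G'} (hR : IsHS R) (hS : IsHS S) :
    Summable fun s => ⟪R (stdBasis G s), S (stdBasis G s)⟫_ℂ := by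
  refine Summable.of_norm_bounded (Summable.add hR hS) fun s => ?_
  refine (norm_inner_le_norm _ _).trans ?_
  nlinarith [sq_nonneg (‖R (stdBasis G s)‖ - ‖S (stdBasis G s)‖), sq_nonneg ‖R (stdBasis G s)‖,
    sq_nonneg ‖S (stdBasis G s)‖]

/-- Cyclicity of the trace for a product of two Hilbert-Schmidt operators. -/
theorem IsHS.tsum_inner_adjoint {R S : G →L[ℂ] G'} (hR : IsHS R) (hS : IsHS S) :
    ∑' t, ⟪S.adjoint (stdBasis G' t), R.adjoint (stdBasis G' t)⟫_ℂ =
      ∑' s, ⟪R (stdBasis G s), S (stdBasis G s)⟫_ℂ := by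
  let F : basisSet G × basisSet G' → ℂ := fun p =>
    ⟪R (stdBasis G p.1), stdBasis G' p.2⟫_ℂ * ⟪stdBasis G' p.2, S (stdBasis G p.1)⟫_ℂ
  -- Absolute summability of the double family, from 2xy ≤ x² + y², permits the exchange of the two
  -- sums.
  have hF : Summable F := by
    refine Summable.of_norm_bounded (Summable.add hR.summable_prod hS.summable_prod) fun p => ?_
    simp only [F, norm_mul]
    rw [norm_inner_symm]
    set x := ‖⟪stdBasis G' p.2, R (stdBasis G p.1)⟫_ℂ‖
    set y := ‖⟪stdBasis G' p.2, S (stdBasis G p.1)⟫_ℂ‖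
    nlinarith [sq_nonneg (x - y), sq_nonneg x, sq_nonneg y]
  have h1 : ∀ t, ∑' s, F (s, t) =
      ⟪S.adjoint (stdBasis G' t), R.adjoint (stdBasis G' t)⟫_ℂ := fun t => by
    refine (tsum_congr fun s => ?_).trans ((stdBasis G).tsum_inner_mul_inner _ _)
    rw [ContinuousLinearMap.adjoint_inner_right, ContinuousLinearMap.adjoint_inner_left, mul_comm]
  have h2 : ∀ s, ∑' t, F (s, t) = ⟪R (stdBasis G s), S (stdBasis G s)⟫_ℂ := fun s =>
    (stdBasis G').tsum_inner_mul_inner (R (stdBasis G s)) (S (stdBasis G s))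
  have h3 : ∑' t, ∑' s, F (s, t) = ∑' s, ∑' t, F (s, t) :=
    Summable.tsum_comm (f := fun s t => F (s, t)) hF
  simpa only [h1, h2] using h3

theorem IsHS.hasSum_trace_adjoint {R S : G →L[ℂ] G'} (hR : IsHS R) (hS : IsHS S) :
    HasSum (fun s => ⟪R (stdBasis G s), S (stdBasis G s)⟫_ℂ) (trace (S ∘L R.adjoint)) := by
  convert (hR.summable_inner hS).hasSum using 1
  rw [← hR.tsum_inner_adjoint hS]
  simp [trace, ContinuousLinearMap.adjoint_inner_left]

/-- This replaces the trace against a positive operator S S* by a sum of vector functionals; all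
later trace computations use it with S built from a square root. -/
theorem IsHS.hasSum_trace_mul {S : G →L[ℂ] G'} (hS : IsHS S) (b : Op G') :
    HasSum (fun s => ⟪S (stdBasis G s), b (S (stdBasis G s))⟫_ℂ) (trace (S ∘L S.adjoint * b)) := by
  have := (hS.comp_left b.adjoint).hasSum_trace_adjoint hS
  rw [ContinuousLinearMap.adjoint_comp, ContinuousLinearMap.adjoint_adjoint] at this
  simpa [ContinuousLinearMap.adjoint_inner_left, ContinuousLinearMap.mul_def,
    ContinuousLinearMap.comp_assoc] using this

/-- The Hilbert-Schmidt norm dominates the operator norm: Parseval bounds the adjoint, which has the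
same norm. -/
theorem norm_sq_apply_le {S : G →L[ℂ] G'} {c : ℝ}
    (hS : HasSum (fun s => ‖S (stdBasis G s)‖ ^ 2) c) (x : G) : ‖S x‖ ^ 2 ≤ c * ‖x‖ ^ 2 := by
  have hc : 0 ≤ c := hS.nonneg fun _ => by positivity
  have h : ∀ y, ‖S.adjoint y‖ ^ 2 ≤ c * ‖y‖ ^ 2 := by
    intro y
    refine hasSum_le (fun s => ?_) (hasSum_norm_sq_inner (stdBasis G) (S.adjoint y))
      (hS.mul_right (‖y‖ ^ 2))
    rw [ContinuousLinearMap.adjoint_inner_right, ← mul_pow]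
    exact pow_le_pow_left₀ (norm_nonneg _) (norm_inner_le_norm _ _) 2
  have h1 : ‖S.adjoint‖ ≤ √c := by
    refine ContinuousLinearMap.opNorm_le_bound _ (Real.sqrt_nonneg _) fun y => ?_
    refine le_of_sq_le_sq ?_ (by positivity) |> fun h => h
    rw [mul_pow, Real.sq_sqrt hc]
    exact h y
  rw [LinearIsometryEquiv.norm_map] at h1
  have h2 := S.le_of_opNorm_le h1 x
  calc ‖S x‖ ^ 2 ≤ (√c * ‖x‖) ^ 2 := pow_le_pow_left₀ (norm_nonneg _) h2 2
    _ = _ := by rw [mul_pow, Real.sq_sqrt hc]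

variable {ρ : Op G}

theorem IsPosTraceClass.sqrt_mul_sqrt (h : IsPosTraceClass ρ) : CFC.sqrt ρ * CFC.sqrt ρ = ρ :=
  CFC.sqrt_mul_sqrt_self ρ ((ContinuousLinearMap.nonneg_iff_isPositive ρ).2 h.pos)

theorem adjoint_sqrt (ρ : Op G) : (CFC.sqrt ρ).adjoint = CFC.sqrt ρ :=
  (ContinuousLinearMap.nonneg_iff_isPositive _).1 (CFC.sqrt_nonneg ρ) |>.isSelfAdjoint

theorem IsPosTraceClass.hasSum_sqrt (h : IsPosTraceClass ρ) :
    HasSum (fun s => ‖CFC.sqrt ρ (stdBasis G s)‖ ^ 2) (trace ρ).re := by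
  have : HasSum _ (trace ρ).re := Complex.hasSum_re h.summable.hasSum
  convert this using 2 with s
  rw [← Complex.ofReal_re (‖CFC.sqrt ρ (stdBasis G s)‖ ^ 2)]
  congr 1
  conv_rhs => rw [← h.sqrt_mul_sqrt]
  rw [mul_apply_eq_comp, ← ContinuousLinearMap.adjoint_inner_left, adjoint_sqrt,
    inner_self_eq_norm_sq_to_K]
  simp

theorem IsPosTraceClass.isHS_sqrt (h : IsPosTraceClass ρ) : IsHS (CFC.sqrt ρ) :=
  h.hasSum_sqrt.summable

theorem IsPosTraceClass.trace_nonneg (h : IsPosTraceClass ρ) : 0 ≤ trace ρ :=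
  tsum_nonneg fun _ => inner_nonneg_of_isPositive h.pos _

theorem IsPosTraceClass.ofReal_trace_re (h : IsPosTraceClass ρ) : ((trace ρ).re : ℂ) = trace ρ :=
  Complex.ext rfl (Complex.le_def.1 h.trace_nonneg).2

/-- The trace is the squared Hilbert-Schmidt norm of √ρ, so a vanishing trace forces √ρ = 0. -/
theorem IsPosTraceClass.trace_re_pos (h : IsPosTraceClass ρ) (h0 : ρ ≠ 0) : 0 < (trace ρ).re := by
  refine lt_of_le_of_ne (Complex.le_def.1 h.trace_nonneg).1 fun hz => h0 ?_
  have h1 : CFC.sqrt ρ = 0 := by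
    ext x
    have := norm_sq_apply_le h.hasSum_sqrt x
    rw [← hz, zero_mul] at this
    exact norm_eq_zero.1 (pow_eq_zero_iff two_ne_zero |>.1 (le_antisymm this (by positivity)))
  rw [← h.sqrt_mul_sqrt, h1, mul_zero]

end HilbertSchmidt

/-! ### One-site operators and product operators in coordinates -/

section Sites

variable {𝓗 : Type*} [NormedAddCommGroup 𝓗] [InnerProductSpace ℂ 𝓗] [CompleteSpace 𝓗]
  {X : Type*}

open Classical in
theorem L2_ext {S F : Type*} [NormedAddCommGroup F] [NormedSpace ℂ F] {A B : L2 S →L[ℂ] F}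
    (h : ∀ s, A (lp.single 2 s (1 : ℂ)) = B (lp.single 2 s (1 : ℂ))) : A = B := by
  ext f
  have hf := lp.hasSum_single (E := fun _ : S => ℂ) (p := 2) (by norm_num) f
  have h1 : ∀ i, lp.single 2 i (f i) = f i • (lp.single 2 i (1 : ℂ) : L2 S) := fun i => by
    rw [← lp.single_smul]; simp
  refine (hf.mapL A).unique ?_
  convert hf.mapL B using 2 with i
  simp only [h1, map_smul, h]

theorem op_ext_stdBasis {F : Type*} [NormedAddCommGroup F] [NormedSpace ℂ F] {A B : 𝓗 →L[ℂ] F}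
    (h : ∀ s, A (stdBasis 𝓗 s) = B (stdBasis 𝓗 s)) : A = B := by
  refine ContinuousLinearMap.ext_on (s := Set.range (stdBasis 𝓗)) ?_ ?_
  · exact Submodule.dense_iff_topologicalClosure_eq_top.2 (stdBasis 𝓗).dense_span
  · rintro _ ⟨s, rfl⟩
    exact h s

section Coord

variable {I : Type*}

theorem siteOpCoord_apply (x : X) (A : Op (L2 I)) (f : L2 (X → I)) (s : X → I) :
    siteOpCoord x A f s = A (slice x s f) (s x) := rfl

open Classical in
theorem slice_apply (x : X) (s : X → I) (f : L2 (X → I)) (r : I) :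
    slice x s f r = f (Function.update s x r) := rfl

open Classical in
theorem slice_update (x : X) (s : X → I) (f : L2 (X → I)) (r : I) :
    slice x (Function.update s x r) f = slice x s f := by
  apply lp.ext
  funext r'
  simp [slice_apply]

open Classical in
theorem slice_siteOpCoord (x : X) (s : X → I) (A : Op (L2 I)) (f : L2 (X → I)) :
    slice x s (siteOpCoord x A f) = A (slice x s f) := by
  apply lp.ext
  funext r
  rw [slice_apply, siteOpCoord_apply, slice_update, Function.update_self]

theorem siteOpCoord_mul (x : X) (A B : Op (L2 I)) :
    siteOpCoord x (A * B) = siteOpCoord x A * siteOpCoord x B := by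
  ext f s
  rw [mul_apply_eq_comp, siteOpCoord_apply, siteOpCoord_apply, slice_siteOpCoord,
    mul_apply_eq_comp]

open Classical in
theorem siteOpCoord_one (x : X) : siteOpCoord x (1 : Op (L2 I)) = 1 := by
  ext f s
  rw [siteOpCoord_apply, one_apply_eq_self, slice_apply, Function.update_eq_self]
  rfl

theorem siteOpCoord_smul (x : X) (c : ℂ) (A : Op (L2 I)) :
    siteOpCoord x (c • A) = c • siteOpCoord x A := by
  ext f s
  rfl

theorem norm_siteOpCoord_le (x : X) (A : Op (L2 I)) : ‖siteOpCoord x A‖ ≤ ‖A‖ :=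
  LinearMap.mkContinuous_norm_le _ (norm_nonneg _) _

end Coord

/-- The matrix of an operator in the chosen orthonormal basis. -/
def coordOp (a : Op 𝓗) : Op (L2 (basisSet 𝓗)) :=
  (stdBasis 𝓗).repr.toContinuousLinearEquiv.toContinuousLinearMap ∘L a ∘L
    (stdBasis 𝓗).repr.symm.toContinuousLinearEquiv.toContinuousLinearMap

theorem coordOp_apply (a : Op 𝓗) (f : L2 (basisSet 𝓗)) :
    coordOp a f = (stdBasis 𝓗).repr (a ((stdBasis 𝓗).repr.symm f)) := rfl

theorem siteOp_eq (x : X) (a : Op 𝓗) : siteOp x a = siteOpCoord x (coordOp a) := rfl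

theorem siteOp_mul (x : X) (a b : Op 𝓗) : siteOp x (a * b) = siteOp x a * siteOp x b := by
  rw [siteOp_eq, siteOp_eq, siteOp_eq, ← siteOpCoord_mul]
  congr 1
  ext1 f
  simp [coordOp_apply]

theorem siteOp_one (x : X) : siteOp x (1 : Op 𝓗) = 1 := by
  rw [siteOp_eq, ← siteOpCoord_one]
  congr 1
  ext1 f
  simp [coordOp_apply]

theorem siteOp_smul (x : X) (c : ℂ) (a : Op 𝓗) : siteOp x (c • a) = c • siteOp x a := by
  rw [siteOp_eq, siteOp_eq, ← siteOpCoord_smul]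
  congr 1
  ext1 f
  simp [coordOp_apply]

theorem norm_siteOp_le (x : X) (a : Op 𝓗) : ‖siteOp x a‖ ≤ ‖a‖ := by
  refine (norm_siteOpCoord_le x _).trans ?_
  refine ContinuousLinearMap.opNorm_le_bound _ (norm_nonneg _) fun f => ?_
  change ‖(stdBasis 𝓗).repr (a ((stdBasis 𝓗).repr.symm f))‖ ≤ _
  rw [LinearIsometryEquiv.norm_map]
  refine (a.le_opNorm _).trans ?_
  rw [LinearIsometryEquiv.norm_map]

open Classical in
theorem coordOp_single (a : Op 𝓗) (t r : basisSet 𝓗) :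
    coordOp a (lp.single 2 t (1 : ℂ)) r = ⟪stdBasis 𝓗 r, a (stdBasis 𝓗 t)⟫_ℂ := by
  rw [coordOp_apply, HilbertBasis.repr_symm_single, HilbertBasis.repr_apply_apply]

open Classical in
theorem basisVec_apply (s t : X → basisSet 𝓗) : basisVec s t = if t = s then (1 : ℂ) else 0 := by
  simp [basisVec, Pi.single_apply]

open Classical in
theorem inner_basisVec (s : X → basisSet 𝓗) (f : HTensor 𝓗 X) : ⟪basisVec s, f⟫_ℂ = f s := by
  rw [basisVec, lp.inner_single_left]; simp

theorem op_ext_basisVec {F : Type*} [NormedAddCommGroup F] [NormedSpace ℂ F]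
    {A B : HTensor 𝓗 X →L[ℂ] F} (h : ∀ s, A (basisVec s) = B (basisVec s)) : A = B :=
  L2_ext h

-- The matrix entries of a product over distinct sites do not depend on the order of the list.
-- Commutation of different sites and the adjoint of a site operator are read off from this formula.
open Classical in
theorem prod_siteOp_basisVec (l : List X) (hl : l.Nodup) (a : X → Op 𝓗)
    (τ s : X → basisSet 𝓗) :
    (l.map fun x => siteOp x (a x)).prod (basisVec τ) s =
      if ∀ z, z ∉ l → s z = τ z then
        (l.map fun x => ⟪stdBasis 𝓗 (s x), a x (stdBasis 𝓗 (τ x))⟫_ℂ).prod else 0 := by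
  induction l generalizing s with
  | nil =>
    simp [basisVec_apply, funext_iff]
  | cons x l ih =>
    obtain ⟨hx, hl⟩ := List.nodup_cons.1 hl
    rw [List.map_cons, List.prod_cons, mul_apply_eq_comp, siteOp_eq, siteOpCoord_apply]
    -- As x is not in l, the remaining factors leave the coordinate at x equal to τ x, so the slice
    -- along x is a multiple of a single basis vector.
    have h1 : slice x s ((l.map fun x => siteOp x (a x)).prod (basisVec τ)) =
        (if ∀ z, z ∉ x :: l → s z = τ z then
          (l.map fun x => ⟪stdBasis 𝓗 (s x), a x (stdBasis 𝓗 (τ x))⟫_ℂ).prod else 0) •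
          (lp.single 2 (τ x) (1 : ℂ) : L2 (basisSet 𝓗)) := by
      apply lp.ext
      funext r
      rw [slice_apply, ih hl]
      have h2 : (l.map fun y => ⟪stdBasis 𝓗 (Function.update s x r y),
          a y (stdBasis 𝓗 (τ y))⟫_ℂ) =
          l.map fun y => ⟪stdBasis 𝓗 (s y), a y (stdBasis 𝓗 (τ y))⟫_ℂ := by
        refine List.map_congr_left fun y hy => ?_
        rw [Function.update_of_ne (by rintro rfl; exact hx hy)]
      rw [h2]
      have h3 : (∀ z, z ∉ l → Function.update s x r z = τ z) ↔
          (∀ z, z ∉ x :: l → s z = τ z) ∧ r = τ x := by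
        constructor
        · intro h
          refine ⟨fun z hz => ?_, by simpa using h x hx⟩
          rw [List.mem_cons, not_or] at hz
          simpa [Function.update_of_ne hz.1] using h z hz.2
        · rintro ⟨h, rfl⟩ z hz
          by_cases hzx : z = x
          · subst hzx; simp
          · rw [Function.update_of_ne hzx]
            exact h z (by simp [hzx, hz])
      simp only [h3, lp.coeFn_smul, Pi.smul_apply, smul_eq_mul, lp.single_apply, Pi.single_apply]
      by_cases h4 : r = τ x
      · simp [h4]
      · simp [h4]
    rw [h1, map_smul, lp.coeFn_smul, Pi.smul_apply, coordOp_single, smul_eq_mul, List.map_cons,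
      List.prod_cons]
    split_ifs
    · rw [mul_comm]
    · rw [zero_mul]

theorem siteOp_commute {x y : X} (hxy : x ≠ y) (a b : Op 𝓗) :
    Commute (siteOp x a) (siteOp y b) := by
  classical
  let c : X → Op 𝓗 := Function.update (fun _ => b) x a
  have hx : c x = a := by simp [c]
  have hy : c y = b := by simp [c, Function.update_of_ne hxy.symm]
  refine op_ext_basisVec fun τ => lp.ext (funext fun s => ?_)
  have h1 := prod_siteOp_basisVec [x, y] (by simp [hxy]) c τ s
  have h2 := prod_siteOp_basisVec [y, x] (by simp [hxy.symm]) c τ s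
  simp only [List.map_cons, List.map_nil, List.prod_cons, List.prod_nil, mul_one, hx, hy] at h1 h2
  rw [h1, h2, mul_comm ⟪stdBasis 𝓗 (s x), _⟫_ℂ]
  simp only [List.mem_cons, not_or, List.not_mem_nil, and_true, not_false_eq_true]
  simp only [and_comm]

open Classical in
theorem siteOp_basisVec (x : X) (a : Op 𝓗) (τ s : X → basisSet 𝓗) :
    siteOp x a (basisVec τ) s =
      if ∀ z, z ≠ x → s z = τ z then ⟪stdBasis 𝓗 (s x), a (stdBasis 𝓗 (τ x))⟫_ℂ else 0 := by
  simpa using prod_siteOp_basisVec [x] (by simp) (fun _ => a) τ s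

theorem siteOp_adjoint (x : X) (a : Op 𝓗) : (siteOp x a).adjoint = siteOp x a.adjoint := by
  classical
  refine op_ext_basisVec fun τ => lp.ext (funext fun s => ?_)
  rw [← inner_basisVec, ContinuousLinearMap.adjoint_inner_right, ← inner_conj_symm,
    inner_basisVec, siteOp_basisVec, siteOp_basisVec]
  have h : (∀ z, z ≠ x → τ z = s z) ↔ ∀ z, z ≠ x → s z = τ z := by simp only [eq_comm]
  simp only [h]
  split_ifs
  · rw [inner_conj_symm, ContinuousLinearMap.adjoint_inner_right]
  · simp

theorem productOp_empty (a : X → Op 𝓗) : productOp ∅ a = 1 := by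
  simp [productOp]

-- The two lists of sites agree only up to a permutation; pairwise commutation makes the products
-- equal.
open Classical in
theorem productOp_insert {x : X} {F : Finset X} (hx : x ∉ F) (a : X → Op 𝓗) :
    productOp (insert x F) a = siteOp x (a x) * productOp F a := by
  rw [productOp, productOp, ← List.prod_cons, ← List.map_cons (f := fun x => siteOp x (a x))]
  refine ((Finset.toList_insert hx).map _).prod_eq' ?_
  rw [List.pairwise_map]
  refine (Finset.nodup_toList _).imp fun h => siteOp_commute h _ _

theorem productOp_congr {F : Finset X} {a b : X → Op 𝓗} (h : ∀ x ∈ F, a x = b x) :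
    productOp F a = productOp F b := by
  rw [productOp, productOp]
  congr 1
  exact List.map_congr_left fun x hx => by rw [h x (Finset.mem_toList.1 hx)]

theorem commute_productOp {F : Finset X} (a : X → Op 𝓗) {R : Op (HTensor 𝓗 X)}
    (h : ∀ x ∈ F, Commute R (siteOp x (a x))) : Commute R (productOp F a) := by
  refine Commute.list_prod_right _ _ fun T hT => ?_
  obtain ⟨x, hx, rfl⟩ := List.mem_map.1 hT
  exact h x (Finset.mem_toList.1 hx)

theorem siteOp_commute_productOp {x : X} {F : Finset X} (hx : x ∉ F) (a : X → Op 𝓗) (b : Op 𝓗) :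
    Commute (siteOp x b) (productOp F a) :=
  commute_productOp a fun _ hy => siteOp_commute (by rintro rfl; exact hx hy) _ _

theorem productOp_mul (F : Finset X) (a b : X → Op 𝓗) :
    productOp F a * productOp F b = productOp F fun x => a x * b x := by
  classical
  induction F using Finset.induction_on with
  | empty => simp [productOp_empty]
  | insert x F hx ih =>
    rw [productOp_insert hx, productOp_insert hx, productOp_insert hx, ← ih, siteOp_mul]
    have := (siteOp_commute_productOp hx a (b x)).eq
    rw [mul_assoc, mul_assoc, ← mul_assoc (productOp F a), ← this, mul_assoc]

theorem productOp_one (F : Finset X) : productOp F (fun _ => (1 : Op 𝓗)) = 1 := by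
  simp [productOp, siteOp_one]

theorem productOp_adjoint (F : Finset X) (a : X → Op 𝓗) :
    (productOp F a).adjoint = productOp F fun x => (a x).adjoint := by
  classical
  induction F using Finset.induction_on with
  | empty => rw [productOp_empty, productOp_empty]; exact star_one _
  | insert x F hx ih =>
    rw [productOp_insert hx, productOp_insert hx, ← ih, ← siteOp_adjoint]
    have h : ∀ A B : Op (HTensor 𝓗 X), (A * B).adjoint = B.adjoint * A.adjoint :=
      ContinuousLinearMap.adjoint_comp
    rw [h, ih, siteOp_adjoint]
    exact (siteOp_commute_productOp hx _ _).symm.eq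

theorem productOp_subset {F F' : Finset X} (hF : F ⊆ F') {a : X → Op 𝓗}
    (h : ∀ x ∈ F', x ∉ F → a x = 1) : productOp F' a = productOp F a := by
  classical
  -- The induction runs over the difference set, with F' varying, and strips off one site carrying
  -- the identity at a time.
  obtain ⟨D, hD⟩ : ∃ D, D = F' \ F := ⟨_, rfl⟩
  induction D using Finset.induction_on generalizing F' with
  | empty =>
    have : F' ⊆ F := Finset.sdiff_eq_empty_iff_subset.1 hD.symm
    rw [this.antisymm hF]
  | insert x D hx ih =>
    have hxD : x ∈ F' \ F := hD ▸ Finset.mem_insert_self x D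
    obtain ⟨h1, h2⟩ := Finset.mem_sdiff.1 hxD
    rw [← Finset.insert_erase h1, productOp_insert (Finset.notMem_erase x F'), h x h1 h2,
      siteOp_one, one_mul]
    refine ih (fun y hy => Finset.mem_erase.2 ⟨fun h => h2 (h ▸ hy), hF hy⟩)
      (fun y hy => h y (Finset.mem_of_mem_erase hy)) ?_
    rw [Finset.erase_sdiff_comm, ← hD, Finset.erase_insert hx]

theorem norm_productOp_le_one (F : Finset X) {a : X → Op 𝓗} (h : ∀ x ∈ F, ‖a x‖ ≤ 1) :
    ‖productOp F a‖ ≤ 1 := by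
  classical
  induction F using Finset.induction_on with
  | empty => rw [productOp_empty]; exact ContinuousLinearMap.norm_id_le
  | insert x F hx ih =>
    rw [productOp_insert hx]
    refine (norm_mul_le _ _).trans (mul_le_one₀ ?_ (norm_nonneg _) ?_)
    · exact (norm_siteOp_le _ _).trans (h x (Finset.mem_insert_self x F))
    · exact ih fun y hy => h y (Finset.mem_insert_of_mem hy)

theorem inner_productOp_univ [Fintype X] (a : X → Op 𝓗) (s τ : X → basisSet 𝓗) :
    ⟪basisVec s, productOp Finset.univ a (basisVec τ)⟫_ℂ =
      ∏ x, ⟪stdBasis 𝓗 (s x), a x (stdBasis 𝓗 (τ x))⟫_ℂ := by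
  classical
  rw [inner_basisVec, productOp, prod_siteOp_basisVec _ (Finset.nodup_toList _), if_pos (by simp),
    Finset.prod_map_toList]

/-! ### Embedding one site by fixing basis vectors at all others -/

section Embedding

open Classical in
theorem norm_slice_le (o : X) (s : X → basisSet 𝓗) (f : HTensor 𝓗 X) : ‖slice o s f‖ ≤ ‖f‖ := by
  have h2 : (0 : ℝ) < (2 : ℝ≥0∞).toReal := by norm_num
  refine lp.norm_le_of_tsum_le h2 (norm_nonneg _) ?_
  rw [lp.norm_rpow_eq_tsum h2 f]
  have h := (lp.hasSum_norm h2 f).summable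
  exact (h.comp_injective (Function.update_injective s o)).tsum_le_tsum_of_inj
    (Function.update s o) (Function.update_injective s o) (fun _ _ => by positivity)
    (fun _ => le_rfl) h

/-- The contraction `⟨b_s| : f ↦ (1_o ⊗ ⟨⨂_{x ≠ o} b (s x)|) f` onto the site `o`. -/
def contract (o : X) (s : X → basisSet 𝓗) : HTensor 𝓗 X →L[ℂ] 𝓗 :=
  (stdBasis 𝓗).repr.symm.toContinuousLinearEquiv.toContinuousLinearMap ∘L
    LinearMap.mkContinuous
      { toFun := slice o s
        map_add' := fun _ _ => lp.ext (funext fun _ => rfl)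
        map_smul' := fun _ _ => lp.ext (funext fun _ => rfl) } 1
      (fun f => by simpa using norm_slice_le o s f)

theorem contract_apply (o : X) (s : X → basisSet 𝓗) (f : HTensor 𝓗 X) :
    contract o s f = (stdBasis 𝓗).repr.symm (slice o s f) := rfl

theorem norm_contract_le (o : X) (s : X → basisSet 𝓗) : ‖contract o s‖ ≤ 1 := by
  refine ContinuousLinearMap.opNorm_le_bound _ zero_le_one fun f => ?_
  rw [contract_apply, LinearIsometryEquiv.norm_map, one_mul]
  exact norm_slice_le o s f

theorem norm_contract_adjoint_apply_le (o : X) (s : X → basisSet 𝓗) (x : 𝓗) :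
    ‖(contract o s).adjoint x‖ ≤ ‖x‖ := by
  have h : ‖(contract o s).adjoint‖ ≤ 1 :=
    (LinearIsometryEquiv.norm_map _ _).trans_le (norm_contract_le o s)
  simpa using (contract o s).adjoint.le_of_opNorm_le h x

theorem contract_siteOp (o : X) (s : X → basisSet 𝓗) (a : Op 𝓗) (f : HTensor 𝓗 X) :
    contract o s (siteOp o a f) = a (contract o s f) := by
  rw [contract_apply, siteOp_eq, slice_siteOpCoord, coordOp_apply]
  simp [contract_apply]

-- The contraction reads only configurations that equal s away from o, and the projection at u acts
-- as the identity on those with coordinate s u.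
open Classical in
theorem contract_siteOp_rankOne {o u : X} (hu : u ≠ o) (s : X → basisSet 𝓗) (f : HTensor 𝓗 X) :
    contract o s (siteOp u
      (InnerProductSpace.rankOne ℂ (stdBasis 𝓗 (s u)) (stdBasis 𝓗 (s u))) f) =
      contract o s f := by
  rw [contract_apply, contract_apply]
  congr 1
  apply lp.ext
  funext r
  rw [slice_apply, siteOp_eq, siteOpCoord_apply, Function.update_of_ne hu, slice_apply,
    coordOp_apply, HilbertBasis.repr_apply_apply, InnerProductSpace.rankOne_apply,
    inner_smul_right, ← HilbertBasis.repr_apply_apply, LinearIsometryEquiv.apply_symm_apply,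
    slice_apply, inner_self_eq_norm_sq_to_K, (stdBasis 𝓗).orthonormal.1]
  rw [← Function.update_of_ne hu r s, Function.update_eq_self]
  simp

theorem contract_productOp_rankOne {o : X} {F : Finset X} (ho : o ∉ F) (s : X → basisSet 𝓗)
    (f : HTensor 𝓗 X) :
    contract o s (productOp F
      (fun u => InnerProductSpace.rankOne ℂ (stdBasis 𝓗 (s u)) (stdBasis 𝓗 (s u))) f) =
      contract o s f := by
  classical
  induction F using Finset.induction_on with
  | empty => simp [productOp_empty]
  | insert x F hx ih =>
    rw [Finset.mem_insert, not_or] at ho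
    rw [productOp_insert hx, mul_apply_eq_comp, contract_siteOp_rankOne (Ne.symm ho.1), ih ho.2]

open Classical in
theorem contract_basisVec (o : X) (s : X → basisSet 𝓗) (r : basisSet 𝓗) :
    contract o s (basisVec (Function.update s o r)) = stdBasis 𝓗 r := by
  rw [contract_apply, ← HilbertBasis.repr_symm_single]
  congr 1
  apply lp.ext
  funext r'
  rw [slice_apply, basisVec_apply, (Function.update_injective s o).eq_iff]
  simp [Pi.single_apply]

/-- The adjoint inserts the vectors b (s x) at the other sites, so it is an isometry; it is enough
to see this on basis vectors. -/
theorem contract_adjoint_apply (o : X) (s : X → basisSet 𝓗) (x : 𝓗) :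
    contract o s ((contract o s).adjoint x) = x := by
  classical
  have h1 : ∀ r, (contract o s).adjoint (stdBasis 𝓗 r) = basisVec (Function.update s o r) := by
    intro r
    apply lp.ext
    funext t
    rw [← inner_basisVec, ContinuousLinearMap.adjoint_inner_right, ← inner_conj_symm,
      ← HilbertBasis.repr_apply_apply, contract_apply, LinearIsometryEquiv.apply_symm_apply,
      slice_apply, basisVec_apply, basisVec_apply]
    simp [eq_comm, apply_ite]
  have h2 : contract o s ∘L (contract o s).adjoint = ContinuousLinearMap.id ℂ 𝓗 :=
    op_ext_stdBasis fun r => by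
      rw [ContinuousLinearMap.comp_apply, h1, contract_basisVec]; rfl
  exact DFunLike.congr_fun h2 x

end Embedding

end Sites

/-! ### The block decomposition of H ⊗ K along the basis of K -/

section TensorProductSpace

variable {H K Λ : Type*} [NormedAddCommGroup H] [InnerProductSpace ℂ H]
  [NormedAddCommGroup K] [InnerProductSpace ℂ K]

variable (H) in
/-- The map `x ↦ x ⊗ y`. -/
def tensorRight (y : K) : H →L[ℂ] HK H K :=
  (UniformSpace.Completion.toComplL : (H ⊗[ℂ] K) →L[ℂ] HK H K) ∘L
    (TensorProduct.mkL ℂ H K).flip y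

theorem tensorRight_apply (y : K) (x : H) :
    tensorRight H y x = ((x ⊗ₜ[ℂ] y : H ⊗[ℂ] K) : HK H K) := rfl

theorem inner_tensorRight (y y' : K) (x x' : H) :
    ⟪tensorRight H y x, tensorRight H y' x'⟫_ℂ = ⟪x, x'⟫_ℂ * ⟪y, y'⟫_ℂ := by
  rw [tensorRight_apply, tensorRight_apply, UniformSpace.Completion.inner_coe,
    TensorProduct.inner_tmul]

theorem HK_eq_zero {z : HK H K} (h : ∀ x y, ⟪tensorRight H y x, z⟫_ℂ = 0) : z = 0 := by
  rw [← inner_self_eq_zero (𝕜 := ℂ)]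
  refine UniformSpace.Completion.induction_on (p := fun w : HK H K => ⟪w, z⟫_ℂ = 0) z
    (isClosed_eq (by fun_prop) (by fun_prop)) fun w => ?_
  induction w using TensorProduct.induction_on with
  | zero => rw [UniformSpace.Completion.coe_zero, inner_zero_left]
  | tmul x y => exact h x y
  | add u v hu hv => rw [UniformSpace.Completion.coe_add, inner_add_left, hu, hv, add_zero]

theorem opTensor_tensorRight (S : Op H) (T : Op K) (x : H) (y : K) :
    opTensor S T (tensorRight H y x) = tensorRight H (T y) (S x) := by
  rw [opTensor]
  exact ContinuousLinearMap.extend_eq _ UniformSpace.Completion.denseRange_coe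
    (UniformSpace.Completion.isUniformInducing_coe _) _

theorem HK_op_ext {A B : Op (HK H K)}
    (h : ∀ x y, A (tensorRight H y x) = B (tensorRight H y x)) : A = B := by
  ext z
  refine UniformSpace.Completion.induction_on (p := fun w : HK H K => A w = B w) z
    (isClosed_eq (by fun_prop) (by fun_prop)) fun w => ?_
  induction w using TensorProduct.induction_on with
  | zero => rw [UniformSpace.Completion.coe_zero, map_zero, map_zero]
  | tmul x y => exact h x y
  | add u v hu hv => rw [UniformSpace.Completion.coe_add, map_add, map_add, hu, hv]

variable [CompleteSpace H] (e : HilbertBasis Λ ℂ K)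

variable (H) in
/-- The isometry `x ↦ x ⊗ |j⟩`. -/
def emb (j : Λ) : H →L[ℂ] HK H K := tensorRight H (e j)

theorem adjoint_emb_tensorRight (j : Λ) (y : K) (x : H) :
    (emb H e j).adjoint (tensorRight H y x) = ⟪e j, y⟫_ℂ • x := by
  refine ext_inner_left ℂ fun z => ?_
  rw [ContinuousLinearMap.adjoint_inner_right, emb, inner_tensorRight, inner_smul_right, mul_comm]

theorem adjoint_emb_emb (j : Λ) (x : H) : (emb H e j).adjoint (emb H e j x) = x := by
  have h := adjoint_emb_tensorRight e j (e j) x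
  rw [inner_self_eq_norm_sq_to_K, e.orthonormal.1] at h
  exact h.trans (by simp)

theorem adjoint_emb_emb_of_ne {i j : Λ} (h : i ≠ j) (x : H) :
    (emb H e i).adjoint (emb H e j x) = 0 := by
  have h' := adjoint_emb_tensorRight e i (e j) x
  rwa [e.orthonormal.2 h, zero_smul] at h'

theorem norm_emb (j : Λ) (x : H) : ‖emb H e j x‖ = ‖x‖ := by
  rw [emb, tensorRight_apply, UniformSpace.Completion.norm_coe, TensorProduct.norm_tmul,
    e.orthonormal.1, mul_one]

/-- This factorisation through H reduces every later computation with M and A to the orthogonality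
relations of the embeddings. -/
theorem opTensor_ketBra (S : Op H) (i j : Λ) :
    opTensor S (OQRW.ketBra e i j) = emb H e i ∘L S ∘L (emb H e j).adjoint := by
  refine HK_op_ext fun x y => ?_
  rw [opTensor_tensorRight, ContinuousLinearMap.comp_apply, ContinuousLinearMap.comp_apply,
    adjoint_emb_tensorRight, OQRW.ketBra, InnerProductSpace.rankOne_apply, map_smul, map_smul, emb,
    tensorRight, tensorRight]
  simp

/-- The orthonormal basis of `H ⊗ K` of the vectors `h_s ⊗ |j⟩`. -/
theorem orthonormal_emb :
    Orthonormal ℂ fun p : Λ × basisSet H => emb H e p.1 (stdBasis H p.2) := by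
  refine ⟨fun p => by rw [norm_emb, (stdBasis H).orthonormal.1], fun p q hpq => ?_⟩
  simp only [emb, inner_tensorRight]
  by_cases h : p.1 = q.1
  · rw [(stdBasis H).orthonormal.2 fun h' => hpq (Prod.ext h h'), zero_mul]
  · rw [e.orthonormal.2 h, mul_zero]

/-- A vector orthogonal to the system has zero component in every block; expanding y in the basis of
K then shows that it is orthogonal to all x ⊗ y. -/
theorem orthogonal_emb_eq_bot :
    (Submodule.span ℂ (Set.range fun p : Λ × basisSet H =>
      emb H e p.1 (stdBasis H p.2)))ᗮ = ⊥ := by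
  rw [Submodule.eq_bot_iff]
  intro z hz
  rw [Submodule.mem_orthogonal] at hz
  have h1 : ∀ j, (emb H e j).adjoint z = 0 := by
    intro j
    have h : HasSum (fun s => ‖⟪stdBasis H s, (emb H e j).adjoint z⟫_ℂ‖ ^ 2) _ :=
      hasSum_norm_sq_inner _ _
    have h0 : ∀ s, ⟪stdBasis H s, (emb H e j).adjoint z⟫_ℂ = 0 := fun s => by
      rw [ContinuousLinearMap.adjoint_inner_right]
      exact hz _ (Submodule.subset_span ⟨(j, s), rfl⟩)
    simp only [h0, norm_zero, ne_eq, OfNat.ofNat_ne_zero, not_false_eq_true, zero_pow] at h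
    exact norm_eq_zero.1 (pow_eq_zero_iff two_ne_zero |>.1 (h.unique hasSum_zero))
  refine HK_eq_zero fun x y => ?_
  have h2 := ((e.hasSum_repr y).mapL ((TensorProduct.mkL ℂ H K) x)).mapL
    (UniformSpace.Completion.toComplL : (H ⊗[ℂ] K) →L[ℂ] HK H K)
  have h3 := h2.mapL (innerSL ℂ z)
  have h4 : ⟪z, tensorRight H y x⟫_ℂ = 0 := by
    refine h3.unique ?_
    convert hasSum_zero with j
    rw [map_smul, map_smul, map_smul, innerSL_apply_apply]
    change _ • ⟪z, emb H e j x⟫_ℂ = 0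
    rw [← ContinuousLinearMap.adjoint_inner_left, h1, inner_zero_left, smul_zero]
  rw [← inner_conj_symm, h4, map_zero]

/-- Parseval in the product basis, summed first over the basis of H inside a block. -/
theorem hasSum_norm_sq_adjoint_emb (z : HK H K) :
    HasSum (fun j => ‖(emb H e j).adjoint z‖ ^ 2) (‖z‖ ^ 2) := by
  let b := HilbertBasis.mkOfOrthogonalEqBot (orthonormal_emb e) (orthogonal_emb_eq_bot (H := H) e)
  have hb : ∀ p, b p = emb H e p.1 (stdBasis H p.2) := fun p => by
    simp only [b, HilbertBasis.coe_mkOfOrthogonalEqBot]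
  refine (hasSum_norm_sq_inner b z).prod_fiberwise fun j => ?_
  convert hasSum_norm_sq_inner (stdBasis H) ((emb H e j).adjoint z) using 3 with s
  rw [hb, ContinuousLinearMap.adjoint_inner_right]

end TensorProductSpace

/-! ### The maps 𝓜_j and the states φ_j and ψ_j -/

section WalkLemmas

variable {H K Λ : Type*} [NormedAddCommGroup H] [InnerProductSpace ℂ H] [CompleteSpace H]
  [NormedAddCommGroup K] [InnerProductSpace ℂ K]

namespace OQRW

variable (W : OQRW H Λ) (e : HilbertBasis Λ ℂ K) (k : ℕ)

theorem M_eq (i j : Λ) : W.M e i j = emb H e i ∘L W.B i j ∘L (emb H e j).adjoint :=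
  opTensor_ketBra e _ i j

theorem M_apply (i j : Λ) (x : HK H K) :
    W.M e i j x = emb H e i (W.B i j ((emb H e j).adjoint x)) := by
  rw [M_eq]; rfl

theorem M_emb (i j : Λ) (x : H) : W.M e i j (emb H e j x) = emb H e i (W.B i j x) := by
  rw [M_apply, adjoint_emb_emb]

theorem M_emb_of_ne {j j' : Λ} (h : j ≠ j') (i : Λ) (x : H) :
    W.M e i j (emb H e j' x) = 0 := by
  rw [M_apply, adjoint_emb_emb_of_ne e h, map_zero, map_zero]

theorem hasSum_norm_sq_B (j : Λ) (y : H) : HasSum (fun i => ‖W.B i j y‖ ^ 2) (‖y‖ ^ 2) := by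
  have h := Complex.hasSum_re ((W.sum_B j y).mapL (innerSL ℂ y))
  simp only [innerSL_apply_apply, ContinuousLinearMap.adjoint_inner_right,
    inner_self_eq_norm_sq_to_K] at h
  convert h using 1
  · funext i; norm_cast
  · norm_cast

theorem hasSum_norm_sq_M_right (j : Λ) (x : HK H K) :
    HasSum (fun i => ‖W.M e i j x‖ ^ 2) (‖(emb H e j).adjoint x‖ ^ 2) := by
  simpa only [M_apply, norm_emb] using W.hasSum_norm_sq_B j ((emb H e j).adjoint x)

/-- In quadratic form this is ∑ M_j^{i*} M_j^i = 1. For fixed j the sum over i gives the squared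
norm of the component in block j, and these add up to ‖x‖². -/
theorem hasSum_norm_sq_M (x : HK H K) :
    HasSum (fun p : Λ × Λ => ‖W.M e p.1 p.2 x‖ ^ 2) (‖x‖ ^ 2) := by
  have h : HasSum (fun q : Λ × Λ => ‖W.M e q.2 q.1 x‖ ^ 2) (‖x‖ ^ 2) :=
    hasSum_prod_of_nonneg (fun _ => by positivity) (fun j => W.hasSum_norm_sq_M_right e j x)
      (hasSum_norm_sq_adjoint_emb e x)
  exact (Equiv.prodComm Λ Λ).hasSum_iff.1 h

theorem isBessel_M : IsBessel fun p : Λ × Λ => W.M e p.1 p.2 :=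
  isBessel_of_hasSum (W.hasSum_norm_sq_M e)

theorem isBessel_M_right (j : Λ) : IsBessel fun i => W.M e i j := fun x s => by
  refine (sum_le_hasSum s (fun _ _ => by positivity) (W.hasSum_norm_sq_M_right e j x)).trans ?_
  simpa using le_hasSum (hasSum_norm_sq_adjoint_emb e x) j fun _ _ => by positivity

theorem hasSum_calM (j : Λ) (a : Op (HK H K)) (x : HK H K) :
    HasSum (fun i => ((W.M e i j).adjoint * a * W.M e i j) x) (W.calM e j a x) :=
  (W.isBessel_M_right e j).hasSum_strongSum (T := fun _ => a) (fun _ => le_rfl) (norm_nonneg a) x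

theorem norm_calM_le (j : Λ) (a : Op (HK H K)) : ‖W.calM e j a‖ ≤ ‖a‖ :=
  (W.isBessel_M_right e j).norm_strongSum_le (T := fun _ => a) (fun _ => le_rfl) (norm_nonneg a)

/-- The operator `∑_j λ_j 𝓜_j(a)`. -/
def weighted (c : Λ → ℂ) (a : Op (HK H K)) : Op (HK H K) :=
  strongSum fun p : Λ × Λ => c p.2 • ((W.M e p.1 p.2).adjoint * a * W.M e p.1 p.2)

section Weighted

variable {c : Λ → ℂ} {C : ℝ}

theorem hasSum_weighted (hc : ∀ j, ‖c j‖ ≤ C) (a : Op (HK H K)) (x : HK H K) :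
    HasSum (fun p : Λ × Λ => c p.2 • (W.M e p.1 p.2).adjoint (a (W.M e p.1 p.2 x)))
      (W.weighted e c a x) := by
  -- No sign is assumed for C; its positive part supplies the nonnegative bound needed for strong
  -- summability.
  have hC : ∀ p : Λ × Λ, ‖c p.2 • a‖ ≤ max C 0 * ‖a‖ := fun p => by
    rw [norm_smul]
    gcongr
    exact (hc _).trans (le_max_left _ _)
  have h := (W.isBessel_M e).hasSum_strongSum hC (by positivity) x
  simpa only [weighted, smul_apply, map_smul, mul_smul_comm,
    smul_mul_assoc] using h

theorem hasSum_weighted_calM (hc : ∀ j, ‖c j‖ ≤ C) (a : Op (HK H K)) (x : HK H K) :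
    HasSum (fun j => c j • W.calM e j a x) (W.weighted e c a x) := by
  have h := (Equiv.prodComm Λ Λ).hasSum_iff.2 (W.hasSum_weighted e hc a x)
  exact h.prod_fiberwise fun j => (W.hasSum_calM e j a x).const_smul (c j)

/-- On block j all M_{j'}^i with j' ≠ j vanish, so only one term of the series survives. -/
theorem weighted_emb (hc : ∀ j, ‖c j‖ ≤ C) (a : Op (HK H K)) (j : Λ) (y : H) :
    W.weighted e c a (emb H e j y) = c j • W.calM e j a (emb H e j y) := by
  refine (W.hasSum_weighted_calM e hc a _).unique ?_
  refine hasSum_single j fun j' hj' => ?_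
  have h := W.hasSum_calM e j' a (emb H e j y)
  simp only [mul_apply_eq_comp, W.M_emb_of_ne e hj', map_zero] at h
  rw [h.unique hasSum_zero, smul_zero]

end Weighted

theorem M_adjoint_apply (i j : Λ) (x : HK H K) :
    (W.M e i j).adjoint x = emb H e j ((W.B i j).adjoint ((emb H e i).adjoint x)) := by
  rw [M_eq, ContinuousLinearMap.adjoint_comp, ContinuousLinearMap.adjoint_comp,
    ContinuousLinearMap.adjoint_adjoint]
  rfl

/-- Block diagonal operators with respect to `H ⊗ K = ⨁_j H ⊗ |j⟩`. -/
def _root_.TreeOQRW.IsBlockDiag (c : Op (HK H K)) : Prop :=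
  ∀ j j', j ≠ j' → ∀ y, (emb H e j).adjoint (c (emb H e j' y)) = 0

theorem isBlockDiag_one : IsBlockDiag (H := H) e 1 := fun _ _ h y =>
  adjoint_emb_emb_of_ne e h y

/-- 𝓜_j(a) has its range in block j because each M_j^{i*} has. This is what keeps the iteration
among block diagonal operators. -/
theorem isBlockDiag_weighted {c : Λ → ℂ} {C : ℝ} (hc : ∀ j, ‖c j‖ ≤ C) (a : Op (HK H K)) :
    IsBlockDiag e (W.weighted e c a) := fun j j' h y => by
  rw [weighted_emb W e hc, map_smul]
  have h1 := (W.hasSum_calM e j' a (emb H e j' y)).mapL (emb H e j).adjoint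
  simp only [mul_apply_eq_comp, M_adjoint_apply, adjoint_emb_emb_of_ne e h] at h1
  rw [h1.unique hasSum_zero, smul_zero]

/-! ### The states `φ_j` and `ψ_j` -/

/-- The vectors of a decomposition of `ρ_j ⊗ |j⟩⟨j|` into operators of rank one. -/
def vec (j : Λ) (s : basisSet H) : HK H K := emb H e j (CFC.sqrt (W.ρ j) (stdBasis H s))

theorem hasSum_norm_sq_vec (j : Λ) :
    HasSum (fun s => ‖W.vec e j s‖ ^ 2) (trace (W.ρ j)).re := by
  simpa only [vec, norm_emb] using (W.ρ_posTraceClass j).hasSum_sqrt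

theorem trace_re_pos (j : Λ) : 0 < (trace (W.ρ j)).re :=
  (W.ρ_posTraceClass j).trace_re_pos (W.ρ_ne_zero j)

theorem trace_ne_zero (j : Λ) : trace (W.ρ j) ≠ 0 := by
  rw [← (W.ρ_posTraceClass j).ofReal_trace_re]
  exact_mod_cast (W.trace_re_pos j).ne'

theorem _root_.TreeOQRW.hasSum_trace_vec (T : Op (HK H K)) (S : H →L[ℂ] HK H K) (hS : IsHS S) {ρ : Op (HK H K)}
    (hρ : S ∘L S.adjoint = ρ) :
    HasSum (fun s => ⟪S (stdBasis H s), T (S (stdBasis H s))⟫_ℂ) (trace (ρ * T)) :=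
  hρ ▸ hS.hasSum_trace_mul T

theorem hasSum_trace_ρ (j : Λ) (b : Op (HK H K)) :
    HasSum (fun s => ⟪W.vec e j s, b (W.vec e j s)⟫_ℂ)
      (trace (opTensor (W.ρ j) (ketBra e j j) * b)) := by
  refine hasSum_trace_vec b _ ((W.ρ_posTraceClass j).isHS_sqrt.comp_left (emb H e j)) ?_
  rw [opTensor_ketBra, ContinuousLinearMap.adjoint_comp, adjoint_sqrt]
  conv_rhs => rw [← (W.ρ_posTraceClass j).sqrt_mul_sqrt]
  rfl

/-- The operator in the trace is S S* with S = emb_i B_j^i √ρ_j, so the vectors are the images under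
M_j^i of those that decompose ρ_j ⊗ |j⟩⟨j|. -/
theorem hasSum_trace_B (i j : Λ) (b : Op (HK H K)) :
    HasSum (fun s => ⟪W.M e i j (W.vec e j s), b (W.M e i j (W.vec e j s))⟫_ℂ)
      (trace (opTensor (W.B i j * W.ρ j * (W.B i j).adjoint) (ketBra e i i) * b)) := by
  have h := hasSum_trace_vec b _ ((W.ρ_posTraceClass j).isHS_sqrt.comp_left (emb H e i ∘L W.B i j))
    (ρ := opTensor (W.B i j * W.ρ j * (W.B i j).adjoint) (ketBra e i i)) (by
      rw [opTensor_ketBra, ContinuousLinearMap.adjoint_comp, ContinuousLinearMap.adjoint_comp,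
        adjoint_sqrt]
      conv_rhs => rw [← (W.ρ_posTraceClass j).sqrt_mul_sqrt]
      rfl)
  simpa only [vec, M_emb, ContinuousLinearMap.comp_apply] using h

theorem hasSum_norm_sq_M_vec (j : Λ) :
    HasSum (fun q : Λ × basisSet H => ‖W.M e q.1 j (W.vec e j q.2)‖ ^ 2) (trace (W.ρ j)).re := by
  have h : HasSum (fun q : basisSet H × Λ => ‖W.M e q.2 j (W.vec e j q.1)‖ ^ 2)
      (trace (W.ρ j)).re := by
    refine hasSum_prod_of_nonneg (fun _ => by positivity) (fun s => ?_) (W.hasSum_norm_sq_vec e j)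
    have := W.hasSum_norm_sq_M_right e j (W.vec e j s)
    rwa [vec, adjoint_emb_emb, ← norm_emb e j] at this
  exact (Equiv.prodComm (basisSet H) Λ).hasSum_iff.1 h

theorem summable_inner_M_vec (j : Λ) (b : Op (HK H K)) :
    Summable fun q : Λ × basisSet H =>
      ⟪W.M e q.1 j (W.vec e j q.2), b (W.M e q.1 j (W.vec e j q.2))⟫_ℂ := by
  refine Summable.of_norm_bounded ((W.hasSum_norm_sq_M_vec e j).summable.mul_left ‖b‖) fun q => ?_
  refine (norm_inner_le_norm _ _).trans ?_
  have := b.le_opNorm (W.M e q.1 j (W.vec e j q.2))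
  nlinarith [norm_nonneg (W.M e q.1 j (W.vec e j q.2))]

theorem summable_trace_B (j : Λ) (b : Op (HK H K)) : Summable fun i =>
    trace (opTensor (W.B i j * W.ρ j * (W.B i j).adjoint) (ketBra e i i) * b) :=
  ((W.summable_inner_M_vec e j b).hasSum.prod_fiberwise
    fun i => W.hasSum_trace_B e i j b).summable

theorem hasSum_ψ (j : Λ) (b : Op (HK H K)) :
    HasSum (fun q : Λ × basisSet H =>
      ⟪W.M e q.1 j (W.vec e j q.2), b (W.M e q.1 j (W.vec e j q.2))⟫_ℂ)
      (trace (W.ρ j) * W.ψ e j b) := by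
  have h := (W.summable_inner_M_vec e j b).hasSum
  rwa [← (h.prod_fiberwise fun i => W.hasSum_trace_B e i j b).tsum_eq,
    ← mul_inv_cancel_left₀ (W.trace_ne_zero j) (∑' i, _)] at h

/-- Both sides are Tr(ρ_j)⁻¹ times the same absolutely convergent double sum over i and the vectors
of ρ_j, taken in the two orders. -/
theorem stateφ_calM (j : Λ) (a : Op (HK H K)) : W.stateφ e j (W.calM e j a) = W.ψ e j a := by
  have h := (Equiv.prodComm (basisSet H) Λ).hasSum_iff.2 (W.hasSum_ψ e j a)
  have h1 := h.prod_fiberwise fun s => by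
    simpa [ContinuousLinearMap.adjoint_inner_right] using
      (W.hasSum_calM e j a (W.vec e j s)).mapL (innerSL ℂ (W.vec e j s))
  rw [stateφ, (W.hasSum_trace_ρ e j _).unique h1, inv_mul_cancel_left₀ (W.trace_ne_zero j)]

/-- The vectors that compute φ_j lie in block j, where the weighted sum reduces to c_j 𝓜_j(a). This
one-step identity drives the recursion over the tree. -/
theorem stateφ_weighted {c : Λ → ℂ} {C : ℝ} (hc : ∀ j, ‖c j‖ ≤ C) (j : Λ) (a : Op (HK H K)) :
    W.stateφ e j (W.weighted e c a) = c j * W.ψ e j a := by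
  rw [← stateφ_calM, stateφ, stateφ, mul_left_comm]
  congr 1
  refine (W.hasSum_trace_ρ e j _).unique ?_
  have h := (W.hasSum_trace_ρ e j (W.calM e j a)).mul_left (c j)
  simp only [← inner_smul_right] at h
  simpa only [vec, weighted_emb W e hc] using h

theorem norm_stateφ_le (j : Λ) (b : Op (HK H K)) : ‖W.stateφ e j b‖ ≤ ‖b‖ := by
  have h1 : ‖trace (opTensor (W.ρ j) (ketBra e j j) * b)‖ ≤ ‖b‖ * (trace (W.ρ j)).re := by
    rw [← (W.hasSum_trace_ρ e j b).tsum_eq]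
    refine tsum_of_norm_bounded ((W.hasSum_norm_sq_vec e j).mul_left ‖b‖) fun s => ?_
    refine (norm_inner_le_norm _ _).trans ?_
    have := b.le_opNorm (W.vec e j s)
    nlinarith [norm_nonneg (W.vec e j s)]
  have h2 : ‖trace (W.ρ j)‖ = (trace (W.ρ j)).re := by
    rw [← (W.ρ_posTraceClass j).ofReal_trace_re, Complex.norm_real, Complex.ofReal_re,
      Real.norm_of_nonneg (W.trace_re_pos j).le]
  rw [stateφ, norm_mul, norm_inv, h2, inv_mul_le_iff₀ (W.trace_re_pos j), mul_comm]
  exact h1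

theorem stateφ_one (j : Λ) : W.stateφ e j 1 = 1 := by
  have h1 : trace (opTensor (W.ρ j) (ketBra e j j) * 1) = trace (W.ρ j) := by
    refine (W.hasSum_trace_ρ e j 1).unique ?_
    rw [← (W.ρ_posTraceClass j).ofReal_trace_re]
    convert Complex.hasSum_ofReal.2 (W.hasSum_norm_sq_vec e j) using 2 with s
    rw [one_apply_eq_self, inner_self_eq_norm_sq_to_K]
    simp
  rw [stateφ, h1, inv_mul_cancel₀ (W.trace_ne_zero j)]

theorem ψ_one (j : Λ) : W.ψ e j 1 = 1 := by
  have h1 : trace (W.ρ j) * W.ψ e j 1 = trace (W.ρ j) := by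
    refine (W.hasSum_ψ e j 1).unique ?_
    rw [← (W.ρ_posTraceClass j).ofReal_trace_re]
    convert Complex.hasSum_ofReal.2 (W.hasSum_norm_sq_M_vec e j) using 2 with s
    rw [one_apply_eq_self, inner_self_eq_norm_sq_to_K]
    simp
  exact mul_left_cancel₀ (W.trace_ne_zero j) (h1.trans (mul_one _).symm)

theorem norm_ψ_le (j : Λ) (b : Op (HK H K)) : ‖W.ψ e j b‖ ≤ ‖b‖ := by
  rw [← stateφ_calM]
  exact (W.norm_stateφ_le e j _).trans (W.norm_calM_le e j b)

end OQRW

end WalkLemmas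

/-! ### Auxiliary facts on series -/

theorem hasSum_of_eq {ι α : Type*} [AddCommMonoid α] [TopologicalSpace α] {f g : ι → α} {a : α}
    (h : ∀ i, f i = g i) (hg : HasSum g a) : HasSum f a :=
  (funext h : f = g) ▸ hg

/-- Complex summability is absolute, so the product of the series expands over all configurations.
It makes the trace over k successors a product of k traces. -/
theorem hasSum_fin_pi_prod {R : Type*} {k : ℕ} {g : Fin k → R → ℂ} {c : Fin k → ℂ}
    (h : ∀ ℓ, HasSum (g ℓ) (c ℓ)) : HasSum (fun r : Fin k → R => ∏ ℓ, g ℓ (r ℓ)) (∏ ℓ, c ℓ) := by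
  induction k with
  | zero => simp
  | succ k ih =>
    have h1 := ih fun ℓ => h ℓ.succ
    have hs : Summable fun p : R × (Fin k → R) => g 0 p.1 * ∏ ℓ, g (Fin.succ ℓ) (p.2 ℓ) :=
      summable_mul_of_summable_norm (f := g 0) (g := fun r : Fin k → R => ∏ ℓ, g (Fin.succ ℓ) (r ℓ))
        (h 0).summable.norm h1.summable.norm
    have h2 := HasSum.mul (f := g 0) (g := fun r : Fin k → R => ∏ ℓ, g (Fin.succ ℓ) (r ℓ))
      (h 0) h1 hs
    rw [Fin.prod_univ_succ, ← (Fin.consEquiv fun _ : Fin (k + 1) => R).hasSum_iff]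
    refine hasSum_of_eq (fun p => ?_) h2
    simp [Fin.prod_univ_succ, Fin.consEquiv]

theorem hasSum_congr_of_eq {ι α : Type*} [AddCommMonoid α] [TopologicalSpace α] {f g : ι → α}
    {a b : α} (h : ∀ i, f i = g i) (hab : b = a) (hg : HasSum g a) : HasSum f b :=
  hab ▸ hasSum_of_eq h hg

/-! ### Orthogonal families and sums of operators -/

section Orthogonal

variable {ι G : Type*} [NormedAddCommGroup G] [InnerProductSpace ℂ G]

theorem inner_sum_of_orthogonal {v : ι → G} (h : ∀ i j, i ≠ j → ⟪v i, v j⟫_ℂ = 0)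
    (s : Finset ι) : ⟪∑ i ∈ s, v i, ∑ i ∈ s, v i⟫_ℂ = ∑ i ∈ s, ⟪v i, v i⟫_ℂ := by
  rw [sum_inner]
  refine Finset.sum_congr rfl fun i hi => ?_
  rw [inner_sum, Finset.sum_eq_single i (fun j _ hj => h i j hj.symm) (fun h => absurd hi h)]

theorem norm_sq_sum_of_orthogonal {v : ι → G} (h : ∀ i j, i ≠ j → ⟪v i, v j⟫_ℂ = 0)
    (s : Finset ι) : ‖∑ i ∈ s, v i‖ ^ 2 = ∑ i ∈ s, ‖v i‖ ^ 2 := by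
  have h1 := inner_sum_of_orthogonal h s
  simp only [inner_self_eq_norm_sq_to_K] at h1
  exact_mod_cast h1

theorem summable_of_orthogonal [CompleteSpace G] {v : ι → G}
    (h : ∀ i j, i ≠ j → ⟪v i, v j⟫_ℂ = 0) (hs : Summable fun i => ‖v i‖ ^ 2) : Summable v := by
  rw [summable_iff_vanishing_norm]
  intro ε hε
  obtain ⟨s, hs⟩ := summable_iff_vanishing_norm.1 hs (ε ^ 2) (by positivity)
  refine ⟨s, fun t ht => ?_⟩
  have h1 := hs t ht
  rw [Real.norm_of_nonneg (by positivity), ← norm_sq_sum_of_orthogonal h] at h1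
  exact lt_of_pow_lt_pow_left₀ 2 hε.le h1

theorem isBessel_of_projections [CompleteSpace G] {Q : ι → Op G}
    (hadj : ∀ i, (Q i).adjoint = Q i) (hidem : ∀ i, Q i * Q i = Q i)
    (horth : ∀ i j, i ≠ j → Q i * Q j = 0) : IsBessel Q := by
  intro x s
  have h0 : ∀ i y, Q i (Q i y) = Q i y := fun i y => DFunLike.congr_fun (hidem i) y
  have h1 : ∀ i j, i ≠ j → ⟪Q i x, Q j x⟫_ℂ = 0 := fun i j hij => by
    rw [← ContinuousLinearMap.adjoint_inner_right, hadj]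
    have : Q i (Q j x) = 0 := DFunLike.congr_fun (horth i j hij) x
    rw [this, inner_zero_right]
  rw [← norm_sq_sum_of_orthogonal h1]
  set v := ∑ i ∈ s, Q i x
  have h2 : ⟪v, v⟫_ℂ = ⟪v, x⟫_ℂ := by
    rw [inner_sum_of_orthogonal h1, sum_inner]
    refine Finset.sum_congr rfl fun i _ => ?_
    rw [← ContinuousLinearMap.adjoint_inner_left, hadj, h0]
  have h3 : ‖v‖ ^ 2 ≤ ‖v‖ * ‖x‖ := by
    have h4 := congrArg norm h2
    rw [inner_self_eq_norm_sq_to_K] at h4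
    simp only [norm_pow, RCLike.norm_ofReal, abs_norm] at h4
    rw [h4]
    exact norm_inner_le_norm _ _
  have h5 : ‖v‖ ≤ ‖x‖ := by
    rcases (norm_nonneg v).eq_or_lt with h | h
    · rw [← h]; exact norm_nonneg _
    · rw [sq] at h3; exact le_of_mul_le_mul_left h3 h
  exact pow_le_pow_left₀ (norm_nonneg _) h5 2

theorem hasSum_norm_sq_of_inner {G' : Type*} [NormedAddCommGroup G'] [InnerProductSpace ℂ G']
    {v : ι → G} {x : G'} (h : HasSum (fun i => ⟪v i, v i⟫_ℂ) ⟪x, x⟫_ℂ) :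
    HasSum (fun i => ‖v i‖ ^ 2) (‖x‖ ^ 2) := by
  have h1 := Complex.hasSum_re h
  simp only [inner_self_eq_norm_sq_to_K] at h1
  exact_mod_cast h1

/-- The two sums are expanded one after the other, so norm convergence of each is enough; no
absolute summability of the double family is needed. -/
theorem hasSum_inner_of_diagonal [DecidableEq ι] [CompleteSpace G] {v w : ι → G} (hv : Summable v)
    (hw : Summable w) (Y : G →L[ℂ] G) {c : ι → ℂ}
    (h : ∀ i j, ⟪v i, Y (w j)⟫_ℂ = if i = j then c i else 0) :
    HasSum c ⟪∑' i, v i, Y (∑' i, w i)⟫_ℂ := by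
  have h1 : ∀ j, ⟪∑' i, v i, Y (w j)⟫_ℂ = c j := by
    intro j
    have h2 := (hv.hasSum.mapL (innerSL ℂ (Y (w j)))).map (starRingEnd ℂ) Complex.continuous_conj
    simp only [Function.comp_def, innerSL_apply_apply, inner_conj_symm, h] at h2
    exact (h2.unique (hasSum_single j fun i hi => if_neg hi)).trans (if_pos rfl)
  have h3 := (hw.hasSum.mapL Y).mapL (innerSL ℂ (∑' i, v i))
  simpa only [innerSL_apply_apply, h1] using h3

/-- Strong convergence of a series of operators does not pass to the adjoints. If the adjoint series
does converge at y, testing against vectors identifies its sum. -/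
theorem eq_adjoint_of_hasSum {G' : Type*} [NormedAddCommGroup G'] [InnerProductSpace ℂ G']
    [CompleteSpace G] [CompleteSpace G'] {T : ι → G →L[ℂ] G'} {S : G →L[ℂ] G'}
    (h : ∀ x, HasSum (fun i => T i x) (S x)) {y : G'} {z : G}
    (hz : HasSum (fun i => (T i).adjoint y) z) : z = S.adjoint y := by
  refine ext_inner_left ℂ fun x => ?_
  have h1 := hz.mapL (innerSL ℂ x)
  have h2 := ((h x).mapL (innerSL ℂ y)).map (starRingEnd ℂ) Complex.continuous_conj
  simp only [Function.comp_def, innerSL_apply_apply, inner_conj_symm,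
    ContinuousLinearMap.adjoint_inner_right] at h1 h2
  rw [ContinuousLinearMap.adjoint_inner_right]
  exact h1.unique h2

end Orthogonal

/-! ### Matrix entries of the partial trace -/

section PartialTrace

variable {𝓗 : Type*} [NormedAddCommGroup 𝓗] [InnerProductSpace ℂ 𝓗] [CompleteSpace 𝓗]

theorem op_ext_inner_stdBasis {S T : Op 𝓗}
    (h : ∀ s t, ⟪stdBasis 𝓗 s, S (stdBasis 𝓗 t)⟫_ℂ = ⟪stdBasis 𝓗 s, T (stdBasis 𝓗 t)⟫_ℂ) :
    S = T := by
  refine op_ext_stdBasis fun t => (stdBasis 𝓗).repr.injective (lp.ext (funext fun s => ?_))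
  simpa only [HilbertBasis.repr_apply_apply] using h s t

theorem partialTrace_eq {k : ℕ} {Y : Op (HTensor 𝓗 (Option (Fin k)))} {T : Op 𝓗}
    (h : ∀ s t : basisSet 𝓗, HasSum (fun r : Fin k → basisSet 𝓗 =>
        ⟪basisVec (fun o : Option (Fin k) => o.elim s r),
          Y (basisVec (fun o : Option (Fin k) => o.elim t r))⟫_ℂ)
        ⟪stdBasis 𝓗 s, T (stdBasis 𝓗 t)⟫_ℂ) : partialTrace Y = T := by
  have h' : ∃ T : Op 𝓗, ∀ s t : basisSet 𝓗, HasSum (fun r : Fin k → basisSet 𝓗 =>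
        ⟪basisVec (fun o : Option (Fin k) => o.elim s r),
          Y (basisVec (fun o : Option (Fin k) => o.elim t r))⟫_ℂ)
        ⟪stdBasis 𝓗 s, T (stdBasis 𝓗 t)⟫_ℂ := ⟨T, h⟩
  rw [partialTrace, dif_pos h']
  exact op_ext_inner_stdBasis fun s t => (h'.choose_spec s t).unique (h s t)

theorem productOp_eq_zero {X : Type*} {F : Finset X} {a : X → Op 𝓗} {x : X} (hx : x ∈ F)
    (h : a x = 0) : productOp F a = 0 := by
  classical
  rw [← Finset.insert_erase hx, productOp_insert (Finset.notMem_erase x F), h]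
  have := siteOp_smul x (0 : ℂ) (0 : Op 𝓗)
  rw [zero_smul, zero_smul] at this
  rw [this, zero_mul]

end PartialTrace

/-! ### Strong convergence of K -/

section Transition

variable {H K Λ : Type*} [NormedAddCommGroup H] [InnerProductSpace ℂ H] [CompleteSpace H]
  [NormedAddCommGroup K] [InnerProductSpace ℂ K]

namespace OQRW

variable (W : OQRW H Λ) (e : HilbertBasis Λ ℂ K) (k : ℕ)

/-- The constant `Tr(ρ_j)^{-1/2}`. -/
def normConst (j : Λ) : ℂ := (((Real.sqrt (trace (W.ρ j)).re)⁻¹ : ℝ) : ℂ)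

theorem normConst_mul_self (j : Λ) : W.normConst j * W.normConst j = (trace (W.ρ j))⁻¹ := by
  rw [normConst, ← Complex.ofReal_mul, ← mul_inv, Real.mul_self_sqrt (W.trace_re_pos j).le,
    Complex.ofReal_inv, (W.ρ_posTraceClass j).ofReal_trace_re]

theorem conj_normConst (j : Λ) : (starRingEnd ℂ) (W.normConst j) = W.normConst j :=
  Complex.conj_ofReal _

theorem norm_normConst (j : Λ) : ‖W.normConst j‖ = (Real.sqrt (trace (W.ρ j)).re)⁻¹ := by
  rw [normConst, Complex.norm_real, Real.norm_of_nonneg (by positivity)]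

theorem A_apply (i j : Λ) (x : HK H K) :
    W.A e i j x = W.normConst j • emb H e i (CFC.sqrt (W.ρ j) ((emb H e j).adjoint x)) := by
  rw [A, opTensor_ketBra]
  rfl

theorem A_adjoint_apply (i j : Λ) (x : HK H K) :
    (W.A e i j).adjoint x =
      W.normConst j • emb H e j (CFC.sqrt (W.ρ j) ((emb H e i).adjoint x)) := by
  refine ext_inner_left ℂ fun z => ?_
  rw [ContinuousLinearMap.adjoint_inner_right, A_apply, inner_smul_left, inner_smul_right,
    conj_normConst, ← ContinuousLinearMap.adjoint_inner_right,
    ← ContinuousLinearMap.adjoint_inner_right, adjoint_sqrt,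
    ContinuousLinearMap.adjoint_inner_left]

theorem norm_M_le_one (i j : Λ) : ‖W.M e i j‖ ≤ 1 := by
  refine ContinuousLinearMap.opNorm_le_bound _ zero_le_one fun x => ?_
  have h := W.isBessel_M e x {(i, j)}
  rw [Finset.sum_singleton] at h
  rw [one_mul]
  exact le_of_sq_le_sq h (norm_nonneg _)

theorem norm_adjoint_emb_le (j : Λ) (x : HK H K) : ‖(emb H e j).adjoint x‖ ≤ ‖x‖ :=
  le_of_sq_le_sq (le_hasSum (hasSum_norm_sq_adjoint_emb e x) j fun _ _ => by positivity)
    (norm_nonneg _)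

theorem norm_A_le_one (i j : Λ) : ‖W.A e i j‖ ≤ 1 := by
  refine ContinuousLinearMap.opNorm_le_bound _ zero_le_one fun x => ?_
  have h0 := W.trace_re_pos j
  have h := norm_sq_apply_le (W.ρ_posTraceClass j).hasSum_sqrt ((emb H e j).adjoint x)
  have h1 : ‖CFC.sqrt (W.ρ j) ((emb H e j).adjoint x)‖ ≤ √(trace (W.ρ j)).re * ‖x‖ := by
    refine le_of_sq_le_sq (h.trans ?_) (by positivity)
    rw [mul_pow, Real.sq_sqrt h0.le]
    have := norm_adjoint_emb_le e j x
    gcongr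
  rw [A_apply, norm_smul, norm_normConst, norm_emb, one_mul, inv_mul_le_iff₀ (by positivity)]
  exact h1

/-- The projection onto `H ⊗ |j⟩`. -/
def blockProj (_ : OQRW H Λ) (j : Λ) : Op (HK H K) := emb H e j ∘L (emb H e j).adjoint

theorem blockProj_apply (j : Λ) (x : HK H K) :
    W.blockProj e j x = emb H e j ((emb H e j).adjoint x) := rfl

theorem blockProj_adjoint (j : Λ) : (W.blockProj e j).adjoint = W.blockProj e j := by
  rw [blockProj, ContinuousLinearMap.adjoint_comp, ContinuousLinearMap.adjoint_adjoint]

theorem blockProj_mul_self (j : Λ) : W.blockProj e j * W.blockProj e j = W.blockProj e j := by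
  ext x
  simp only [mul_apply_eq_comp, blockProj_apply, adjoint_emb_emb]

theorem blockProj_mul_of_ne {i j : Λ} (h : i ≠ j) : W.blockProj e i * W.blockProj e j = 0 := by
  ext x
  simp only [mul_apply_eq_comp, blockProj_apply, adjoint_emb_emb_of_ne e h, map_zero]
  rfl

/-- The projection onto the block `i` at a vertex and the block `j` at its direct successors. -/
def proj (i j : Λ) : Op (HTensor (HK H K) (Option (Fin k))) :=
  productOp Finset.univ fun o => o.elim (W.blockProj e i) fun _ => W.blockProj e j

/-- The projections must be orthogonal also when only the successor index differs, which requires at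
least one successor. -/
theorem isBessel_proj (hk : 1 ≤ k) : IsBessel fun p : Λ × Λ => W.proj e k p.1 p.2 := by
  refine isBessel_of_projections (fun p => ?_) (fun p => ?_) fun p q hpq => ?_
  · rw [proj, productOp_adjoint]
    refine productOp_congr fun o _ => ?_
    cases o <;> exact W.blockProj_adjoint e _
  · rw [proj, productOp_mul]
    refine productOp_congr fun o _ => ?_
    cases o <;> exact W.blockProj_mul_self e _
  · rw [proj, proj, productOp_mul]
    by_cases h : p.1 = q.1
    · exact productOp_eq_zero (Finset.mem_univ (some ⟨0, hk⟩))
        (W.blockProj_mul_of_ne e fun h' => hpq (Prod.ext h h'))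
    · exact productOp_eq_zero (Finset.mem_univ none) (W.blockProj_mul_of_ne e h)

/-- M_j^{i*} goes from block i to block j while A_j^i goes from j to i, so the indices are exchanged
between the two projections. -/
theorem proj_kraus_proj (i j : Λ) :
    (W.proj e k j i).adjoint * (W.kraus e k i j * W.proj e k i j) = W.kraus e k i j := by
  have h1 : (W.proj e k j i).adjoint = productOp Finset.univ _ := productOp_adjoint _ _
  have h2 : W.kraus e k i j * W.proj e k i j = productOp Finset.univ _ := productOp_mul _ _ _
  have h3 : productOp Finset.univ _ * productOp Finset.univ _ = productOp Finset.univ _ :=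
    productOp_mul Finset.univ (fun o : Option (Fin k) => (o.elim (W.blockProj e j)
      fun _ => W.blockProj e i).adjoint) (fun o => o.elim (W.M e i j).adjoint (fun _ => W.A e i j) *
        o.elim (W.blockProj e i) fun _ => W.blockProj e j)
  rw [h1, h2, h3, kraus]
  refine productOp_congr fun o _ => ?_
  cases o
  · ext x
    simp only [Option.elim_none, mul_apply_eq_comp, blockProj_adjoint, blockProj_apply,
      M_adjoint_apply, adjoint_emb_emb]
  · ext x
    simp only [Option.elim_some, mul_apply_eq_comp, blockProj_adjoint, blockProj_apply,
      A_apply, adjoint_emb_emb, map_smul]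

theorem norm_kraus_le_one (i j : Λ) : ‖W.kraus e k i j‖ ≤ 1 := by
  refine norm_productOp_le_one _ fun o _ => ?_
  cases o
  · exact (LinearIsometryEquiv.norm_map _ _).trans_le (W.norm_M_le_one e i j)
  · exact W.norm_A_le_one e i j

/-- The terms are contractions between mutually orthogonal initial blocks and mutually orthogonal
final blocks, so their sum is a case of `exists_hasSum_sandwich`. -/
theorem hasSum_totalKraus (hk : 1 ≤ k) (f : HTensor (HK H K) (Option (Fin k))) :
    HasSum (fun p : Λ × Λ => W.kraus e k p.1 p.2 f) (W.totalKraus e k f) := by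
  have hR : IsBessel fun p : Λ × Λ => W.proj e k p.2 p.1 := fun x s => by
    simpa using W.isBessel_proj e k hk x (s.map (Equiv.prodComm Λ Λ).toEmbedding)
  obtain ⟨S, -, hS⟩ := exists_hasSum_sandwich hR (W.isBessel_proj e k hk)
    (T := fun p => W.kraus e k p.1 p.2) (fun p => W.norm_kraus_le_one e k p.1 p.2) zero_le_one
  have h : ∀ x, HasSum (fun p : Λ × Λ => W.kraus e k p.1 p.2 x) (S x) := fun x =>
    hasSum_of_eq (fun p => (DFunLike.congr_fun (W.proj_kraus_proj e k p.1 p.2) x).symm) (hS x)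
  exact strongSum_hasSum (f := fun p : Λ × Λ => W.kraus e k p.1 p.2) ⟨S, h⟩ f

end OQRW

end Transition

/-! ### The partial trace of K Y K* on product elements -/

section TransitionProduct

variable {H K Λ : Type*} [NormedAddCommGroup H] [InnerProductSpace ℂ H] [CompleteSpace H]
  [NormedAddCommGroup K] [InnerProductSpace ℂ K]

namespace OQRW

variable (W : OQRW H Λ) (e : HilbertBasis Λ ℂ K) (k : ℕ)

-- By cyclicity the factor emb_{i'}* emb_i appears and vanishes for i ≠ i'. For i = i' and j ≠ j'
-- the middle factor emb_j* c emb_{j'} vanishes because c is block diagonal. What remains is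
-- Tr(ρ_j)⁻¹ Tr(√ρ_j C √ρ_j), with C the block of c at j.
open Classical in
theorem hasSum_inner_A {c : Op (HK H K)} (hc : IsBlockDiag e c) (p p' : Λ × Λ) :
    HasSum (fun r => ⟪stdBasis (HK H K) r,
      (W.A e p.1 p.2 * c * (W.A e p'.1 p'.2).adjoint) (stdBasis (HK H K) r)⟫_ℂ)
      (if p = p' then W.stateφ e p.2 c else 0) := by
  obtain ⟨i, j⟩ := p
  obtain ⟨i', j'⟩ := p'
  let S : H →L[ℂ] HK H K := emb H e i ∘L CFC.sqrt (W.ρ j)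
  let S' : H →L[ℂ] HK H K := emb H e i' ∘L CFC.sqrt (W.ρ j')
  obtain ⟨C, hC⟩ : ∃ C : Op H, C = (emb H e j).adjoint ∘L c ∘L emb H e j' := ⟨_, rfl⟩
  have hS : IsHS S := (W.ρ_posTraceClass j).isHS_sqrt.comp_left _
  have hS' : IsHS S' := (W.ρ_posTraceClass j').isHS_sqrt.comp_left _
  have hR : IsHS (S' ∘L C.adjoint) := hS'.comp_right _
  have h1 : ∀ x : HK H K, ⟪x, (W.A e i j * c * (W.A e i' j').adjoint) x⟫_ℂ =
      W.normConst j * W.normConst j' * ⟪S.adjoint x, (S' ∘L C.adjoint).adjoint x⟫_ℂ := by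
    intro x
    rw [ContinuousLinearMap.adjoint_inner_left, mul_apply_eq_comp, mul_apply_eq_comp, A_apply,
      A_adjoint_apply, ContinuousLinearMap.adjoint_comp, ContinuousLinearMap.adjoint_adjoint]
    simp only [map_smul, inner_smul_right, ContinuousLinearMap.adjoint_comp, adjoint_sqrt,
      ContinuousLinearMap.comp_apply, S, S', hC]
    ring
  have h2 := (hS.adjoint.summable_inner hR.adjoint).hasSum
  -- The trace of S C S'* becomes a sum over the basis of H, in which the two embeddings meet.
  rw [hR.tsum_inner_adjoint hS] at h2
  refine hasSum_congr_of_eq (fun r => h1 _) ?_ (h2.mul_left (W.normConst j * W.normConst j'))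
  by_cases hij : (i, j) = (i', j')
  · obtain ⟨rfl, rfl⟩ := Prod.mk.inj hij
    have hs := (W.ρ_posTraceClass j).isHS_sqrt
    have h3 : ∀ s, ⟪(S' ∘L C.adjoint) (stdBasis H s), S (stdBasis H s)⟫_ℂ =
        ⟪(C ∘L CFC.sqrt (W.ρ j)).adjoint (stdBasis H s),
          (CFC.sqrt (W.ρ j)).adjoint (stdBasis H s)⟫_ℂ := by
      intro s
      rw [ContinuousLinearMap.adjoint_comp, adjoint_sqrt]
      change ⟪emb H e i _, emb H e i _⟫_ℂ = _
      rw [← ContinuousLinearMap.adjoint_inner_right (emb H e i), adjoint_emb_emb]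
      rfl
    rw [if_pos rfl, tsum_congr h3, hs.tsum_inner_adjoint (hs.comp_left C), normConst_mul_self,
      stateφ]
    congr 1
    refine (W.hasSum_trace_ρ e j c).unique ?_
    refine hasSum_of_eq (fun s => ?_) (hs.summable_inner (hs.comp_left C)).hasSum
    simp only [vec, hC, ContinuousLinearMap.comp_apply, ContinuousLinearMap.adjoint_inner_right]
  · rw [if_neg hij]
    have h3 : ∀ s, ⟪(S' ∘L C.adjoint) (stdBasis H s), S (stdBasis H s)⟫_ℂ = 0 := by
      intro s
      simp only [S, S', ContinuousLinearMap.comp_apply]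
      rw [← ContinuousLinearMap.adjoint_inner_right]
      by_cases hi : i = i'
      · have hj : j ≠ j' := fun hj => hij (by rw [hi, hj])
        have hC0 : C = 0 := by
          ext y
          rw [hC]
          exact hc j j' hj y
        rw [hC0, map_zero]
        simp
      · rw [adjoint_emb_emb_of_ne e (Ne.symm hi), inner_zero_right]
    rw [tsum_congr h3, tsum_zero, mul_zero]

/-- The basis vector of a vertex in the state `s` and its direct successors in the states `r`. -/
def familyVec (s : basisSet (HK H K)) (r : Fin k → basisSet (HK H K)) :
    HTensor (HK H K) (Option (Fin k)) :=
  basisVec fun o : Option (Fin k) => o.elim s r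

/-- The observable `a ⊗ c_1 ⊗ ⋯ ⊗ c_k`. -/
def familyOp (a : Op (HK H K)) (c : Fin k → Op (HK H K)) :
    Op (HTensor (HK H K) (Option (Fin k))) :=
  productOp Finset.univ fun o => o.elim a c

theorem inner_familyVec (s t : basisSet (HK H K)) (r : Fin k → basisSet (HK H K))
    (a : Op (HK H K)) (c : Fin k → Op (HK H K)) :
    ⟪familyVec k s r, familyOp k a c (familyVec k t r)⟫_ℂ =
      ⟪stdBasis (HK H K) s, a (stdBasis (HK H K) t)⟫_ℂ *
        ∏ ℓ, ⟪stdBasis (HK H K) (r ℓ), c ℓ (stdBasis (HK H K) (r ℓ))⟫_ℂ := by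
  rw [familyVec, familyVec, familyOp, inner_productOp_univ, Fintype.prod_option]
  rfl

theorem kraus_familyOp_kraus (p p' : Λ × Λ) (a : Op (HK H K)) (c : Fin k → Op (HK H K)) :
    W.kraus e k p.1 p.2 * (familyOp k a c * (W.kraus e k p'.1 p'.2).adjoint) =
      familyOp k ((W.M e p.1 p.2).adjoint * a * W.M e p'.1 p'.2)
        fun ℓ => W.A e p.1 p.2 * c ℓ * (W.A e p'.1 p'.2).adjoint := by
  have h1 : (W.kraus e k p'.1 p'.2).adjoint = productOp Finset.univ _ := productOp_adjoint _ _
  have h2 : familyOp k a c * productOp Finset.univ _ = productOp Finset.univ _ :=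
    productOp_mul Finset.univ _ (fun o : Option (Fin k) =>
      (o.elim (W.M e p'.1 p'.2).adjoint fun _ => W.A e p'.1 p'.2).adjoint)
  have h3 : W.kraus e k p.1 p.2 * productOp Finset.univ _ = productOp Finset.univ _ :=
    productOp_mul Finset.univ _ (fun o : Option (Fin k) => o.elim a c *
      (o.elim (W.M e p'.1 p'.2).adjoint fun _ => W.A e p'.1 p'.2).adjoint)
  rw [h1, h2, h3, familyOp]
  refine productOp_congr fun o _ => ?_
  cases o
  · simp only [Option.elim_none, ContinuousLinearMap.adjoint_adjoint, mul_assoc]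
  · simp only [Option.elim_some, mul_assoc]

open Classical in
theorem hasSum_inner_kraus {c : Fin k → Op (HK H K)} (hk : 1 ≤ k) (hc : ∀ ℓ, IsBlockDiag e (c ℓ))
    (a : Op (HK H K)) (p p' : Λ × Λ) (s t : basisSet (HK H K)) :
    HasSum (fun r => ⟪(W.kraus e k p.1 p.2).adjoint (familyVec k s r),
        familyOp k a c ((W.kraus e k p'.1 p'.2).adjoint (familyVec k t r))⟫_ℂ)
      (if p = p' then (∏ ℓ, W.stateφ e p.2 (c ℓ)) *
        ⟪W.M e p.1 p.2 (stdBasis (HK H K) s), a (W.M e p.1 p.2 (stdBasis (HK H K) t))⟫_ℂ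
        else 0) := by
  have h := (hasSum_fin_pi_prod fun ℓ => W.hasSum_inner_A e (hc ℓ) p p').mul_left
    ⟪stdBasis (HK H K) s, ((W.M e p.1 p.2).adjoint * a * W.M e p'.1 p'.2)
      (stdBasis (HK H K) t)⟫_ℂ
  refine hasSum_congr_of_eq (fun r => ?_) ?_ h
  · rw [ContinuousLinearMap.adjoint_inner_left]
    have h1 := DFunLike.congr_fun (W.kraus_familyOp_kraus e k p p' a c) (familyVec k t r)
    rw [mul_apply_eq_comp, mul_apply_eq_comp] at h1
    rw [h1]
    exact inner_familyVec k s t r _ _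
  · split_ifs with hp
    · subst hp
      rw [mul_comm, mul_apply_eq_comp, mul_apply_eq_comp, ContinuousLinearMap.adjoint_inner_right]
    -- A cross term is a product of k zeros; for k = 0 it would be an empty product and survive.
    · rw [Finset.prod_const, Finset.card_univ, Fintype.card_fin, zero_pow (by omega), mul_zero]

open Classical in
theorem hasSum_inner_kraus_one (hk : 1 ≤ k) (p p' : Λ × Λ) (s t : basisSet (HK H K)) :
    HasSum (fun r => ⟪(W.kraus e k p.1 p.2).adjoint (familyVec k s r),
        (W.kraus e k p'.1 p'.2).adjoint (familyVec k t r)⟫_ℂ)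
      (if p = p' then
        ⟪W.M e p.1 p.2 (stdBasis (HK H K) s), W.M e p.1 p.2 (stdBasis (HK H K) t)⟫_ℂ
        else 0) := by
  have h := W.hasSum_inner_kraus e k hk (c := fun _ => 1) (fun _ => isBlockDiag_one e) 1 p p' s t
  have h1 : familyOp (H := H) (K := K) k 1 (fun _ => 1) = 1 := by
    rw [familyOp, ← productOp_one Finset.univ]
    refine productOp_congr fun o _ => ?_
    cases o <;> rfl
  simpa only [h1, one_apply_eq_self, stateφ_one, Finset.prod_const_one, one_mul] using h

theorem hasSum_norm_sq_kraus (hk : 1 ≤ k) (p : Λ × Λ) (s : basisSet (HK H K)) :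
    HasSum (fun r => ‖(W.kraus e k p.1 p.2).adjoint (familyVec k s r)‖ ^ 2)
      (‖W.M e p.1 p.2 (stdBasis (HK H K) s)‖ ^ 2) := by
  have h := W.hasSum_inner_kraus_one e k hk p p s s
  exact hasSum_norm_sq_of_inner (G := HTensor (HK H K) (Option (Fin k))) (G' := HK H K)
    (hasSum_congr_of_eq (fun _ => rfl) (if_pos rfl).symm h)

/-- The square-summable family `r ↦ K_j^{i*} (b_s ⊗ b_r)`. -/
def krausFamily (hk : 1 ≤ k) (p : Λ × Λ) (s : basisSet (HK H K)) :
    lp (fun _ : Fin k → basisSet (HK H K) => HTensor (HK H K) (Option (Fin k))) 2 :=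
  ⟨fun r => (W.kraus e k p.1 p.2).adjoint (familyVec k s r),
    (memℓp_gen_iff (by norm_num : (0 : ℝ) < (2 : ℝ≥0∞).toReal)).2 (by
      simpa using (W.hasSum_norm_sq_kraus e k hk p s).summable)⟩

-- The sum over r in the partial trace is an inner product in a space of square-summable families.
-- There the terms of K* become orthogonal for different indices, which handles the interchange of
-- the partial trace with the double series for K Y K*.
open Classical in
theorem inner_krausFamily (hk : 1 ≤ k) (p p' : Λ × Λ) (s t : basisSet (HK H K)) :
    ⟪W.krausFamily e k hk p s, W.krausFamily e k hk p' t⟫_ℂ =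
      if p = p' then
        ⟪W.M e p.1 p.2 (stdBasis (HK H K) s), W.M e p.1 p.2 (stdBasis (HK H K) t)⟫_ℂ
      else 0 :=
  (lp.hasSum_inner _ _).unique (W.hasSum_inner_kraus_one e k hk p p' s t)

theorem summable_krausFamily (hk : 1 ≤ k) (s : basisSet (HK H K)) :
    Summable fun p => W.krausFamily e k hk p s := by
  classical
  refine summable_of_orthogonal (fun p p' h => ?_) ?_
  · rw [inner_krausFamily, if_neg h]
  · refine (W.hasSum_norm_sq_M e (stdBasis (HK H K) s)).summable.congr fun p => ?_
    have h := W.inner_krausFamily e k hk p p s s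
    rw [if_pos rfl, inner_self_eq_norm_sq_to_K, inner_self_eq_norm_sq_to_K] at h
    exact_mod_cast h.symm

/-- Evaluation at r is continuous on square-summable families, so the adjoint series converges on
these vectors, and its sum can only be K*. -/
theorem tsum_krausFamily_apply (hk : 1 ≤ k) (s : basisSet (HK H K))
    (r : Fin k → basisSet (HK H K)) :
    (∑' p, W.krausFamily e k hk p s) r = (W.totalKraus e k).adjoint (familyVec k s r) :=
  eq_adjoint_of_hasSum (W.hasSum_totalKraus e k hk)
    ((W.summable_krausFamily e k hk s).hasSum.mapL
      (lp.evalCLM ℂ (fun _ : Fin k → basisSet (HK H K) =>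
        HTensor (HK H K) (Option (Fin k))) 2 r))

open Classical in
theorem hasSum_inner_totalKraus {c : Fin k → Op (HK H K)} (hk : 1 ≤ k)
    (hc : ∀ ℓ, IsBlockDiag e (c ℓ)) (a : Op (HK H K)) (s t : basisSet (HK H K)) :
    ∃ z : ℂ, HasSum (fun r => ⟪(W.totalKraus e k).adjoint (familyVec k s r),
        familyOp k a c ((W.totalKraus e k).adjoint (familyVec k t r))⟫_ℂ) z ∧
      HasSum (fun p : Λ × Λ => (∏ ℓ, W.stateφ e p.2 (c ℓ)) *
        ⟪W.M e p.1 p.2 (stdBasis (HK H K) s), a (W.M e p.1 p.2 (stdBasis (HK H K) t))⟫_ℂ) z := by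
  -- The observable acts on each member of the family; it does not mix different indices of the
  -- orthogonal sum.
  let Y := lp.mapCLM (α := Fin k → basisSet (HK H K)) (𝕜 := ℂ)
    (E := fun _ => HTensor (HK H K) (Option (Fin k)))
    (F := fun _ => HTensor (HK H K) (Option (Fin k))) 2
    (fun _ => familyOp k a c) (norm_nonneg (familyOp k a c)) (fun _ => le_rfl)
  refine ⟨_, hasSum_of_eq (fun r => ?_) (lp.hasSum_inner (𝕜 := ℂ)
    (G := fun _ : Fin k → basisSet (HK H K) => HTensor (HK H K) (Option (Fin k)))
    (∑' p, W.krausFamily e k hk p s) (Y (∑' p, W.krausFamily e k hk p t))),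
    hasSum_inner_of_diagonal (W.summable_krausFamily e k hk s)
    (W.summable_krausFamily e k hk t) Y fun p p' =>
    (lp.hasSum_inner _ _).unique (W.hasSum_inner_kraus e k hk hc a p p' s t)⟩
  exact congrArg₂ (inner ℂ) (W.tsum_krausFamily_apply e k hk s r).symm
    (congrArg (familyOp k a c) (W.tsum_krausFamily_apply e k hk t r).symm)

theorem norm_prod_stateφ_le (c : Fin k → Op (HK H K)) (j : Λ) :
    ‖∏ ℓ, W.stateφ e j (c ℓ)‖ ≤ ∏ ℓ, ‖c ℓ‖ := by
  rw [norm_prod]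
  exact Finset.prod_le_prod (fun _ _ => norm_nonneg _) fun ℓ _ => W.norm_stateφ_le e j _

/-- On `a ⊗ c_1 ⊗ ⋯ ⊗ c_k` with block diagonal `c_ℓ` the two transition expectations agree. -/
theorem prodTransitionExp_eq (hk : 1 ≤ k) (a : Op (HK H K)) {c : Fin k → Op (HK H K)}
    (hc : ∀ ℓ, IsBlockDiag e (c ℓ)) :
    W.prodTransitionExp e k a c = W.diagTransitionExp e k a c := by
  -- A bounded operator with the required matrix entries exists, so the default value of
  -- `partialTrace` plays no role.
  refine partialTrace_eq fun s t => ?_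
  obtain ⟨z, h1, h2⟩ := W.hasSum_inner_totalKraus e k hk hc a s t
  have h3 := (W.hasSum_weighted e (W.norm_prod_stateφ_le e k c) a (stdBasis (HK H K) t)).mapL
    (innerSL ℂ (stdBasis (HK H K) s))
  simp only [innerSL_apply_apply, inner_smul_right, ContinuousLinearMap.adjoint_inner_right] at h3
  refine hasSum_congr_of_eq (fun r => ?_) (h3.unique h2) h1
  rw [ContinuousLinearMap.adjoint_inner_left]
  rfl

end OQRW

end TransitionProduct

/-! ### Balls, annuli and spheres of the tree -/

section TreeLemmas

variable {k : ℕ}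

theorem mem_ball {n : ℕ} {u : Vertex k} : u ∈ ball k n ↔ u.length ≤ n := by
  simp [ball]

theorem mem_annulus {n : ℕ} {u : Vertex k} : u ∈ annulus k n ↔ u.length ≤ n ∧ 1 ≤ u.length := by
  rw [annulus, Finset.mem_filter, mem_ball]

theorem ball_mono {m n : ℕ} (h : m ≤ n) : ball k m ⊆ ball k n := fun _ hu =>
  mem_ball.2 ((mem_ball.1 hu).trans h)

theorem annulus_mono {m n : ℕ} (h : m ≤ n) : annulus k m ⊆ annulus k n := fun _ hu =>
  mem_annulus.2 ⟨(mem_annulus.1 hu).1.trans h, (mem_annulus.1 hu).2⟩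

theorem ball_eq_insert (k n : ℕ) : ball k n = insert [] (annulus k n) := by
  ext u
  rw [Finset.mem_insert, mem_ball, mem_annulus]
  cases u <;> simp

theorem nil_notMem_annulus (k n : ℕ) : [] ∉ annulus k n := by
  simp [mem_annulus]

/-- `W_n`, the vertices at distance `n` from the root. -/
def sphere (k n : ℕ) : Finset (Vertex k) := (ball k n).filter fun u => u.length = n

theorem mem_sphere {n : ℕ} {u : Vertex k} : u ∈ sphere k n ↔ u.length = n := by
  rw [sphere, Finset.mem_filter, mem_ball]
  exact ⟨fun h => h.2, fun h => ⟨h.le, h⟩⟩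

theorem annulus_succ (k n : ℕ) : annulus k (n + 1) = annulus k n ∪ sphere k (n + 1) := by
  ext u
  rw [Finset.mem_union, mem_annulus, mem_annulus, mem_sphere]
  omega

theorem prod_annulus_succ {R : Type*} [CommMonoid R] (n : ℕ) (f : Vertex k → R) :
    ∏ u ∈ annulus k (n + 1), f u = (∏ u ∈ annulus k n, f u) * ∏ u ∈ sphere k (n + 1), f u := by
  rw [annulus_succ, Finset.prod_union]
  rw [Finset.disjoint_left]
  intro u hu hu'
  rw [mem_annulus] at hu
  rw [mem_sphere] at hu'
  omega

theorem prod_sphere_succ {R : Type*} [CommMonoid R] (n : ℕ) (f : Vertex k → R) :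
    ∏ u ∈ sphere k (n + 1), f u = ∏ u ∈ sphere k n, ∏ ℓ, f (u ++ [ℓ]) := by
  rw [← Finset.prod_product']
  symm
  refine Finset.prod_bij (fun p _ => p.1 ++ [p.2]) ?_ ?_ ?_ fun _ _ => rfl
  · intro p hp
    rw [Finset.mem_product, mem_sphere] at hp
    rw [mem_sphere, List.length_append, hp.1, List.length_singleton]
  · intro p _ q _ h
    obtain ⟨h1, h2⟩ := List.append_inj' h rfl
    exact Prod.ext h1 (List.singleton_inj.1 h2)
  · intro u hu
    rw [mem_sphere] at hu
    rcases List.eq_nil_or_concat' u with rfl | ⟨v, ℓ, rfl⟩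
    · simp at hu
    · refine ⟨(v, ℓ), ?_, rfl⟩
      rw [Finset.mem_product, mem_sphere]
      exact ⟨by simpa using hu, Finset.mem_univ _⟩

theorem sphere_zero (k : ℕ) : sphere k 0 = {[]} := by
  ext u
  rw [mem_sphere, Finset.mem_singleton, List.length_eq_zero_iff]

end TreeLemmas

/-! ### The iterated transition expectations -/

section Iteration

variable {H K Λ : Type*} [NormedAddCommGroup H] [InnerProductSpace ℂ H] [CompleteSpace H]
  [NormedAddCommGroup K] [InnerProductSpace ℂ K]

namespace OQRW

variable (W : OQRW H Λ) (e : HilbertBasis Λ ℂ K) {k : ℕ}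

/-- The transition expectation agrees with the diagonal one on `a ⊗ c_1 ⊗ ⋯ ⊗ c_k` with block
diagonal `c_1, …, c_k`. -/
def IsTransition (𝓔 : Op (HK H K) → (Fin k → Op (HK H K)) → Op (HK H K)) : Prop :=
  ∀ a c, (∀ ℓ, IsBlockDiag e (c ℓ)) →
    𝓔 a c = W.weighted e (fun j => ∏ ℓ, W.stateφ e j (c ℓ)) a

theorem isTransition_of_eq (hk : 1 ≤ k) {𝓔 : Op (HK H K) → (Fin k → Op (HK H K)) → Op (HK H K)}
    (h : 𝓔 = W.prodTransitionExp e k ∨ 𝓔 = W.diagTransitionExp e k) : W.IsTransition e 𝓔 := by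
  rcases h with rfl | rfl
  · intro a c hc
    exact W.prodTransitionExp_eq e k hk a hc
  · intro a c _
    rfl

variable {𝓔 : Op (HK H K) → (Fin k → Op (HK H K)) → Op (HK H K)}

/-- The outermost sphere enters through φ_j, all inner vertices through ψ_j. Applying the
expectation at level n + 1 converts each outer φ_j-factor into the ψ_j of the parent times the φ_j
of its successors. -/
theorem iterExp_eq (h𝓔 : W.IsTransition e 𝓔) (n : ℕ) {a : Vertex k → Op (HK H K)}
    (ha : ∀ u : Vertex k, u.length = n + 1 → IsBlockDiag e (a u)) :
    iterExp 𝓔 n a = W.weighted e (fun j => (∏ u ∈ annulus k n, W.ψ e j (a u)) *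
      ∏ u ∈ sphere k (n + 1), W.stateφ e j (a u)) (a []) := by
  induction n generalizing a with
  | zero =>
    have h1 : levelExp 𝓔 0 a [] = 𝓔 (a []) fun ℓ => a ([] ++ [ℓ]) := by simp [levelExp]
    rw [iterExp, h1, h𝓔 _ _ fun ℓ => ha _ (by simp)]
    congr 1
    funext j
    have h2 : annulus k 0 = ∅ := by
      ext u
      rw [mem_annulus]
      simp
    rw [prod_sphere_succ, sphere_zero, Finset.prod_singleton, h2, Finset.prod_empty, one_mul]
  | succ n ih =>
    have h1 : ∀ u : Vertex k, u.length = n + 1 → levelExp 𝓔 (n + 1) a u =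
        W.weighted e (fun j => ∏ ℓ, W.stateφ e j (a (u ++ [ℓ]))) (a u) := fun u hu => by
      rw [levelExp, if_neg (by omega), if_pos hu, h𝓔 _ _ fun ℓ => ha _ (by simp [hu])]
    have h2 : ∀ u : Vertex k, u.length < n + 1 → levelExp 𝓔 (n + 1) a u = a u := fun u hu => by
      rw [levelExp, if_pos hu]
    -- The new observables at level n + 1 are values of the transition expectation, hence block
    -- diagonal, as the induction hypothesis demands.
    rw [iterExp, ih fun u hu => by
      rw [h1 u hu]
      exact W.isBlockDiag_weighted e (W.norm_prod_stateφ_le e k _) _]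
    rw [h2 [] (by simp)]
    congr 1
    funext j
    have h3 : ∀ u ∈ annulus k n, W.ψ e j (levelExp 𝓔 (n + 1) a u) = W.ψ e j (a u) :=
      fun u hu => by rw [h2 u (by have := mem_annulus.1 hu; omega)]
    have h4 : ∀ u ∈ sphere k (n + 1), W.stateφ e j (levelExp 𝓔 (n + 1) a u) =
        (∏ ℓ, W.stateφ e j (a (u ++ [ℓ]))) * W.ψ e j (a u) := fun u hu => by
      rw [h1 u (mem_sphere.1 hu), W.stateφ_weighted e (W.norm_prod_stateφ_le e k _)]
    rw [Finset.prod_congr rfl h3, Finset.prod_congr rfl h4, prod_annulus_succ,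
      prod_sphere_succ (n + 1), Finset.prod_mul_distrib]
    ring

theorem prod_ψ_pad {m n : ℕ} (hmn : m ≤ n) (a : Vertex k → Op (HK H K)) (j : Λ) :
    ∏ u ∈ annulus k n, W.ψ e j (pad m a u) = ∏ u ∈ annulus k m, W.ψ e j (a u) := by
  rw [← Finset.prod_subset (annulus_mono hmn) fun u hu hu' => by
    have h2 := mem_annulus.1 hu
    rw [mem_annulus] at hu'
    rw [pad, if_neg (by omega), ψ_one]]
  exact Finset.prod_congr rfl fun u hu => by rw [pad, if_pos (mem_annulus.1 hu).1]

theorem iterExp_pad (h𝓔 : W.IsTransition e 𝓔) {m n : ℕ} (hmn : m ≤ n)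
    (a : Vertex k → Op (HK H K)) :
    iterExp 𝓔 n (pad m a) = W.weighted e (fun j => ∏ u ∈ annulus k m, W.ψ e j (a u)) (a []) := by
  rw [W.iterExp_eq e h𝓔 n fun u hu => by
    rw [pad, if_neg (by omega)]; exact isBlockDiag_one e]
  have h0 : pad m a [] = a [] := by rw [pad, if_pos (by simp)]
  rw [h0]
  congr 1
  funext j
  have h1 : ∏ u ∈ sphere k (n + 1), W.stateφ e j (pad m a u) = 1 :=
    Finset.prod_eq_one fun u hu => by
      rw [pad, if_neg (by have := mem_sphere.1 hu; omega), stateφ_one]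
  rw [h1, mul_one, prod_ψ_pad W e hmn]

theorem norm_prod_ψ_le (F : Finset (Vertex k)) (a : Vertex k → Op (HK H K)) (j : Λ) :
    ‖∏ u ∈ F, W.ψ e j (a u)‖ ≤ ∏ u ∈ F, ‖a u‖ := by
  rw [norm_prod]
  exact Finset.prod_le_prod (fun _ _ => norm_nonneg _) fun u _ => W.norm_ψ_le e j _

end OQRW

end Iteration

/-! ### Positive contractions that evaluate states at sites -/

section SiteMaps

variable {𝓗 : Type*} [NormedAddCommGroup 𝓗] [InnerProductSpace ℂ 𝓗] [CompleteSpace 𝓗]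
  {X ι : Type*}

/-- The projection onto a vector of the chosen orthonormal basis. -/
def basisProj (b : basisSet 𝓗) : Op 𝓗 :=
  InnerProductSpace.rankOne ℂ (stdBasis 𝓗 b) (stdBasis 𝓗 b)

/-- The Kraus operators |w_m⟩⟨b| at the site u replace a by its expectation times |b⟩⟨b|. Leaving a
projection instead of 1 keeps the map on one space with a Bessel Kraus family; the projection is
absorbed later by `exists_rootEmbedding`. -/
theorem exists_siteMap (u : X) (b : basisSet 𝓗) {w : ι → 𝓗}
    (hw : HasSum (fun m => ‖w m‖ ^ 2) 1) :
    ∃ Φ : Op (HTensor 𝓗 X) →L[ℂ] Op (HTensor 𝓗 X), IsPosContraction Φ ∧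
      ∀ (a : Op 𝓗) (R : Op (HTensor 𝓗 X)) (c : ℂ), HasSum (fun m => ⟪w m, a (w m)⟫_ℂ) c →
        (∀ x, Commute (siteOp u x) R) →
        Φ (siteOp u a * R) = c • (siteOp u (basisProj b) * R) := by
  let V : ι → Op 𝓗 := fun m => InnerProductSpace.rankOne ℂ (w m) (stdBasis 𝓗 b)
  have hK : IsBessel fun m => siteOp u (V m) := by
    intro f s
    calc ∑ m ∈ s, ‖siteOp u (V m) f‖ ^ 2 ≤ ∑ m ∈ s, ‖w m‖ ^ 2 * ‖f‖ ^ 2 := by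
          refine Finset.sum_le_sum fun m _ => ?_
          rw [← mul_pow]
          refine pow_le_pow_left₀ (norm_nonneg _) ((siteOp u (V m)).le_of_opNorm_le ?_ f) 2
          refine (norm_siteOp_le _ _).trans ?_
          rw [InnerProductSpace.norm_rankOne, (stdBasis 𝓗).orthonormal.1, mul_one]
      _ = (∑ m ∈ s, ‖w m‖ ^ 2) * ‖f‖ ^ 2 := by rw [Finset.sum_mul]
      _ ≤ 1 * ‖f‖ ^ 2 := by
          gcongr
          exact sum_le_hasSum s (fun _ _ => by positivity) hw
      _ = ‖f‖ ^ 2 := one_mul _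
  obtain ⟨Φ, hΦ, hS⟩ := exists_krausMap hK
    (Θ := fun _ => ContinuousLinearMap.id ℂ (Op (HTensor 𝓗 X))) fun _ => isPosContraction_id
  refine ⟨Φ, hΦ, fun a R c hc hR => ContinuousLinearMap.ext fun f => ?_⟩
  refine (hS _ f).unique ?_
  have hV : ∀ m, (V m).adjoint * a * V m = ⟪w m, a (w m)⟫_ℂ • basisProj b := by
    intro m
    ext x
    simp only [V, mul_apply_eq_comp, InnerProductSpace.adjoint_rankOne, smul_apply, basisProj,
      InnerProductSpace.rankOne_apply, map_smul, smul_smul]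
    rw [mul_comm]
  have h1 : ∀ m, (siteOp u (V m)).adjoint * (siteOp u a * R * siteOp u (V m)) =
      ⟪w m, a (w m)⟫_ℂ • (siteOp u (basisProj b) * R) := by
    intro m
    rw [siteOp_adjoint, mul_assoc (siteOp u a), ← (hR (V m)).eq, ← mul_assoc, ← mul_assoc,
      ← siteOp_mul, ← siteOp_mul, hV, siteOp_smul, smul_mul_assoc]
  refine hasSum_of_eq (fun m => DFunLike.congr_fun (h1 m) f) ?_
  exact hc.smul_const ((siteOp u (basisProj b) * R) f)

/-- The one-site maps are composed. The commuting factor R carries the sites outside F, so that it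
can hold the newly inserted site during the induction. -/
theorem exists_productMap (F : Finset X) (b : basisSet 𝓗) {w : ι → 𝓗}
    (hw : HasSum (fun m => ‖w m‖ ^ 2) 1) :
    ∃ Θ : Op (HTensor 𝓗 X) →L[ℂ] Op (HTensor 𝓗 X), IsPosContraction Θ ∧
      ∀ (a : X → Op 𝓗) (R : Op (HTensor 𝓗 X)) (c : X → ℂ),
        (∀ u, HasSum (fun m => ⟪w m, a u (w m)⟫_ℂ) (c u)) →
        (∀ u ∈ F, ∀ x, Commute (siteOp u x) R) →
        Θ (productOp F a * R) = (∏ u ∈ F, c u) • (productOp F (fun _ => basisProj b) * R) := by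
  classical
  induction F using Finset.induction_on with
  | empty =>
    refine ⟨ContinuousLinearMap.id ℂ _, isPosContraction_id, fun a R c _ _ => ?_⟩
    rw [productOp_empty, productOp_empty, Finset.prod_empty, one_smul]
    rfl
  | insert u F hu ih =>
    obtain ⟨Θ, hΘ, hΘF⟩ := ih
    obtain ⟨Φ, hΦ, hΦu⟩ := exists_siteMap u b hw
    refine ⟨Φ ∘L Θ, hΦ.comp hΘ, fun a R c hc hR => ?_⟩
    have hR' : ∀ x, Commute (siteOp u x) R := hR u (Finset.mem_insert_self u F)
    have h1 : productOp (insert u F) a * R = productOp F a * (siteOp u (a u) * R) := by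
      rw [productOp_insert hu, (siteOp_commute_productOp hu a (a u)).eq, mul_assoc]
    have h2 : Θ (productOp F a * (siteOp u (a u) * R)) = (∏ u ∈ F, c u) •
        (siteOp u (a u) * (productOp F (fun _ => basisProj b) * R)) := by
      rw [hΘF a _ c hc fun v hv x => (siteOp_commute (by rintro rfl; exact hu hv) _ _).mul_right
        (hR v (Finset.mem_insert_of_mem hv) x), ← mul_assoc, ← mul_assoc,
        (siteOp_commute_productOp hu _ (a u)).eq]
    have h3 := hΦu (a u) (productOp F (fun _ => basisProj b) * R) (c u) (hc u) fun x =>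
      (siteOp_commute_productOp hu _ x).mul_right (hR' x)
    rw [ContinuousLinearMap.comp_apply, h1, h2, map_smul, h3, smul_smul, Finset.prod_insert hu,
      mul_comm (c u), productOp_insert hu, mul_assoc]

/-- J places the vector b at every site other than o, where it is fixed by the projections left over
from the site maps. -/
theorem exists_rootEmbedding (o : X) (b : basisSet 𝓗) :
    ∃ J : 𝓗 →L[ℂ] HTensor 𝓗 X, (∀ x, ‖J x‖ ≤ ‖x‖) ∧
      ∀ (F : Finset X) (a : Op 𝓗) (y : 𝓗), o ∉ F →
        J.adjoint (productOp F (fun _ => basisProj b) (siteOp o a (J y))) = a y := by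
  refine ⟨(contract o fun _ => b).adjoint, norm_contract_adjoint_apply_le o _, fun F a y hF => ?_⟩
  have h1 := contract_productOp_rankOne hF (fun _ => b)
    (siteOp o a ((contract o fun _ => b).adjoint y))
  rw [ContinuousLinearMap.adjoint_adjoint]
  exact h1.trans ((contract_siteOp _ _ _ _).trans (congrArg a (contract_adjoint_apply _ _ _)))

-- For each m the non-root sites are first evaluated in the state belonging to m, and the result is
-- then compressed by J M_m. Since J is contractive, these operators remain a Bessel family.
open Classical in
theorem exists_rootMap {κ : Type*} {o : X} {F : Finset X} (ho : o ∉ F) (b : basisSet 𝓗)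
    {M : ι → Op 𝓗} (hM : IsBessel M) {w : ι → κ → 𝓗}
    (hw : ∀ m, HasSum (fun q => ‖w m q‖ ^ 2) 1) :
    ∃ Φ : Op (HTensor 𝓗 X) →L[ℂ] Op 𝓗, IsPosContraction Φ ∧
      ∀ (a : X → Op 𝓗) (c : ι → X → ℂ),
        (∀ m u, HasSum (fun q => ⟪w m q, a u (w m q)⟫_ℂ) (c m u)) →
        ∀ x, HasSum (fun m => (∏ u ∈ F, c m u) • (M m).adjoint (a o (M m x)))
          (Φ (productOp (insert o F) a) x) := by
  choose Θ hΘ hΘ' using fun m => exists_productMap F b (hw m)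
  obtain ⟨J, hJ1, hJ2⟩ := exists_rootEmbedding o b
  have hJ : IsBessel fun m => J ∘L M m := fun x s => by
    refine (Finset.sum_le_sum fun m _ => ?_).trans (hM x s)
    exact pow_le_pow_left₀ (norm_nonneg _) (hJ1 _) 2
  obtain ⟨Φ, hΦ, hS⟩ := exists_krausMap hJ hΘ
  refine ⟨Φ, hΦ, fun a c hc x => hasSum_of_eq (fun m => ?_) (hS _ x)⟩
  have h1 : productOp (insert o F) a = productOp F a * siteOp o (a o) := by
    rw [productOp_insert ho, (siteOp_commute_productOp ho a (a o)).eq]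
  have h2 : Θ m (productOp (insert o F) a) = (∏ u ∈ F, c m u) •
      (productOp F (fun _ => basisProj b) * siteOp o (a o)) := by
    rw [h1]
    exact hΘ' m a _ _ (hc m) fun u hu x => siteOp_commute (by rintro rfl; exact ho hu) _ _
  rw [h2, ContinuousLinearMap.adjoint_comp]
  have h3 := hJ2 F (a o) (M m x) ho
  exact ((congrArg (fun y => (M m).adjoint y) ((map_smul J.adjoint _ _).trans
    (congrArg _ h3))).trans (map_smul _ _ _)).symm

end SiteMaps

/-! ### The root expectation in a finite volume -/

section FiniteVolume

/-- There is a positive contraction with the values `L a` on the product elements of `Λ_n`. -/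
abbrev HasVolumeMap {𝓗 : Type*} [NormedAddCommGroup 𝓗] [InnerProductSpace ℂ 𝓗] [CompleteSpace 𝓗]
    {k : ℕ} (n : ℕ) (L : (Vertex k → Op 𝓗) → Op 𝓗) : Prop :=
  ∃ Φ : Op (HTensor 𝓗 (Vertex k)) →L[ℂ] Op 𝓗, IsPosContraction Φ ∧
    ∀ a, Φ (productOp (ball k n) a) = L a

variable {H K Λ : Type*} [NormedAddCommGroup H] [InnerProductSpace ℂ H] [CompleteSpace H]
  [NormedAddCommGroup K] [InnerProductSpace ℂ K]

namespace OQRW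

variable (W : OQRW H Λ) (e : HilbertBasis Λ ℂ K) (k : ℕ)

/-- In a zero space the vectors decomposing ρ_j would vanish although Tr(ρ_j) > 0; so Λ would be
empty, against ∑ Tr(ρ_j) = 1. -/
theorem nonempty_basisSet (W : OQRW H Λ) (e : HilbertBasis Λ ℂ K) : Nonempty (basisSet (HK H K)) := by
  by_contra h
  rw [not_nonempty_iff] at h
  have h0 : ∀ x : HK H K, x = 0 := fun x => by
    have h1 : HasSum _ (‖x‖ ^ 2) := hasSum_norm_sq_inner (stdBasis (HK H K)) x
    exact norm_eq_zero.1 (pow_eq_zero_iff two_ne_zero |>.1 (h1.unique hasSum_empty))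
  have hΛ : IsEmpty Λ := ⟨fun j => by
    have h2 := W.hasSum_norm_sq_vec e j
    simp only [h0 (W.vec e j _), norm_zero, ne_eq, OfNat.ofNat_ne_zero, not_false_eq_true,
      zero_pow] at h2
    exact (W.trace_re_pos j).ne' (h2.unique hasSum_zero)⟩
  exact one_ne_zero (W.sum_ρ.unique hasSum_empty)

/-- The vectors of a decomposition of the density operator of `ψ_j` into operators of rank one. -/
def psiVec (j : Λ) (q : Λ × basisSet H) : HK H K :=
  W.normConst j • W.M e q.1 j (W.vec e j q.2)

theorem hasSum_norm_sq_psiVec (j : Λ) : HasSum (fun q => ‖W.psiVec e j q‖ ^ 2) 1 := by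
  have h0 := W.trace_re_pos j
  refine hasSum_congr_of_eq (fun q => ?_) ?_
    ((W.hasSum_norm_sq_M_vec e j).mul_left (‖W.normConst j‖ ^ 2))
  · rw [psiVec, norm_smul, mul_pow]
  · rw [norm_normConst, inv_pow, Real.sq_sqrt h0.le, inv_mul_cancel₀ h0.ne']

theorem hasSum_inner_psiVec (j : Λ) (b : Op (HK H K)) :
    HasSum (fun q => ⟪W.psiVec e j q, b (W.psiVec e j q)⟫_ℂ) (W.ψ e j b) := by
  refine hasSum_congr_of_eq (fun q => ?_) ?_
    ((W.hasSum_ψ e j b).mul_left (W.normConst j * W.normConst j))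
  · rw [psiVec, map_smul, inner_smul_left, inner_smul_right, conj_normConst, mul_assoc]
  · rw [normConst_mul_self, inv_mul_cancel_left₀ (W.trace_ne_zero j)]

/-- The conditional expectation onto the root in the volume `Λ_n`. -/
theorem exists_finiteVolumeExp (n : ℕ) :
    HasVolumeMap n fun a : Vertex k → Op (HK H K) =>
      W.weighted e (fun j => ∏ u ∈ annulus k n, W.ψ e j (a u)) (a []) := by
  obtain ⟨b⟩ := W.nonempty_basisSet e
  obtain ⟨Φ, hΦ, hS⟩ := exists_rootMap (nil_notMem_annulus k n) b (W.isBessel_M e)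
    fun p => W.hasSum_norm_sq_psiVec e p.2
  refine ⟨Φ, hΦ, fun a => ContinuousLinearMap.ext fun x => ?_⟩
  have h := hS a (fun p u => W.ψ e p.2 (a u)) (fun p u => W.hasSum_inner_psiVec e p.2 (a u)) x
  -- The two insertions differ only in the instance of decidable equality.
  have hb : ball k n = @insert _ _ (@Finset.instInsert _ fun _ _ => Classical.propDecidable _) []
    (annulus k n) := by convert ball_eq_insert k n
  rw [hb]
  exact h.unique (W.hasSum_weighted e (W.norm_prod_ψ_le e _ a) (a []) x)

end OQRW

end FiniteVolume

/-! ### Density of the local product elements -/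

section QuasiLocal

variable {𝓗 : Type*} [NormedAddCommGroup 𝓗] [InnerProductSpace ℂ 𝓗] [CompleteSpace 𝓗] {k : ℕ}

theorem productOp_ball_pad {m n : ℕ} (h : m ≤ n) (a : Vertex k → Op 𝓗) :
    productOp (ball k n) (pad m a) = productOp (ball k m) a := by
  rw [productOp_subset (ball_mono h) fun u _ hu => by
    rw [mem_ball] at hu
    rw [pad, if_neg hu]]
  exact productOp_congr fun u hu => by rw [pad, if_pos (mem_ball.1 hu)]

variable (𝓗 k) in
/-- The linear span of the local product elements. -/
def localSpan : Submodule ℂ (Op (HTensor 𝓗 (Vertex k))) :=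
  Submodule.span ℂ {T | ∃ (n : ℕ) (a : Vertex k → Op 𝓗), T = productOp (ball k n) a}

theorem productOp_mem_localSpan (n : ℕ) (a : Vertex k → Op 𝓗) :
    productOp (ball k n) a ∈ localSpan 𝓗 k :=
  Submodule.subset_span ⟨n, a, rfl⟩

theorem siteOp_mem_localSpan (u : Vertex k) (a : Op 𝓗) : siteOp u a ∈ localSpan 𝓗 k := by
  classical
  have h1 : productOp {u} (Function.update (fun _ => 1) u a) = siteOp u a := by
    rw [productOp, Finset.toList_singleton]
    simp
  rw [← h1, ← productOp_subset (F' := ball k u.length)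
    (Finset.singleton_subset_iff.2 (mem_ball.2 le_rfl))
    fun v _ hv => Function.update_of_ne (by simpa using hv) _ _]
  exact productOp_mem_localSpan _ _

theorem mul_mem_localSpan {S T : Op (HTensor 𝓗 (Vertex k))} (hS : S ∈ localSpan 𝓗 k)
    (hT : T ∈ localSpan 𝓗 k) : S * T ∈ localSpan 𝓗 k := by
  induction hS using Submodule.span_induction with
  | mem S hS =>
    obtain ⟨m, a, rfl⟩ := hS
    induction hT using Submodule.span_induction with
    | mem T hT =>
      obtain ⟨n, b, rfl⟩ := hT
      rw [← productOp_ball_pad (le_max_left m n) a, ← productOp_ball_pad (le_max_right m n) b,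
        productOp_mul]
      exact productOp_mem_localSpan _ _
    | zero => rw [mul_zero]; exact Submodule.zero_mem _
    | add S T _ _ h1 h2 => rw [mul_add]; exact Submodule.add_mem _ h1 h2
    | smul c T _ h => rw [mul_smul_comm]; exact Submodule.smul_mem _ c h
  | zero => rw [zero_mul]; exact Submodule.zero_mem _
  | add S T _ _ h1 h2 => rw [add_mul]; exact Submodule.add_mem _ h1 h2
  | smul c T _ h => rw [smul_mul_assoc]; exact Submodule.smul_mem _ c h

theorem star_mem_localSpan {T : Op (HTensor 𝓗 (Vertex k))} (hT : T ∈ localSpan 𝓗 k) :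
    star T ∈ localSpan 𝓗 k := by
  induction hT using Submodule.span_induction with
  | mem T hT =>
    obtain ⟨m, a, rfl⟩ := hT
    rw [ContinuousLinearMap.star_eq_adjoint, productOp_adjoint]
    exact productOp_mem_localSpan _ _
  | zero => rw [star_zero]; exact Submodule.zero_mem _
  | add S T _ _ h1 h2 => rw [star_add]; exact Submodule.add_mem _ h1 h2
  | smul c T _ h => rw [star_smul]; exact Submodule.smul_mem _ _ h

/-- The span of the local products is already a *-algebra: two products are multiplied after padding
both to a common ball. -/
theorem adjoin_subset_localSpan {T : Op (HTensor 𝓗 (Vertex k))}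
    (hT : T ∈ StarAlgebra.adjoin ℂ {T | ∃ (x : Vertex k) (a : Op 𝓗), T = siteOp x a}) :
    T ∈ localSpan 𝓗 k := by
  induction hT using StarAlgebra.adjoin_induction with
  | mem T hT =>
    obtain ⟨x, a, rfl⟩ := hT
    exact siteOp_mem_localSpan x a
  | algebraMap c =>
    rw [Algebra.algebraMap_eq_smul_one, ← productOp_one (ball k 0)]
    exact Submodule.smul_mem _ c (productOp_mem_localSpan _ _)
  | add S T _ _ h1 h2 => exact Submodule.add_mem _ h1 h2
  | mul S T _ _ h1 h2 => exact mul_mem_localSpan h1 h2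
  | star T _ h => exact star_mem_localSpan h

theorem mem_closure_localSpan (T : quasiLocal 𝓗 (Vertex k)) :
    (T : Op (HTensor 𝓗 (Vertex k))) ∈ closure (localSpan 𝓗 k : Set _) :=
  closure_mono (fun _ h => adjoin_subset_localSpan h) T.2

/-- Bounded linear maps on the quasi-local algebra are determined by their values on the local
product elements. -/
theorem quasiLocal_ext {F : Type*} [NormedAddCommGroup F] [NormedSpace ℂ F]
    {A B : quasiLocal 𝓗 (Vertex k) →L[ℂ] F}
    (h : ∀ n a, A (productElt (ball k n) a) = B (productElt (ball k n) a)) : A = B := by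
  have h1 : ∀ T : Op (HTensor 𝓗 (Vertex k)), T ∈ localSpan 𝓗 k →
      ∃ hT : T ∈ quasiLocal 𝓗 (Vertex k), A ⟨T, hT⟩ = B ⟨T, hT⟩ := by
    intro T hT
    induction hT using Submodule.span_induction with
    | mem T hT =>
      obtain ⟨m, a, rfl⟩ := hT
      exact ⟨productOp_mem _ _, h m a⟩
    | zero => exact ⟨zero_mem _, (map_zero A).trans (map_zero B).symm⟩
    | add S T _ _ hS hT =>
      obtain ⟨hS, hS'⟩ := hS
      obtain ⟨hT, hT'⟩ := hT
      refine ⟨add_mem hS hT, ?_⟩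
      have := congrArg₂ (· + ·) hS' hT'
      simp only [← map_add] at this
      exact this
    | smul c T _ hT =>
      obtain ⟨hT, hT'⟩ := hT
      refine ⟨SMulMemClass.smul_mem c hT, ?_⟩
      have := congrArg (c • ·) hT'
      simp only [← map_smul] at this
      exact this
  ext T
  obtain ⟨x, hx, hxT⟩ := mem_closure_iff_seq_limit.1 (mem_closure_localSpan T)
  choose hq hAB using fun n => h1 (x n) (hx n)
  have h2 : Tendsto (fun n => (⟨x n, hq n⟩ : quasiLocal 𝓗 (Vertex k))) atTop (𝓝 T) :=
    tendsto_subtype_rng.2 hxT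
  have h3 := (A.continuous.tendsto T).comp h2
  have h4 := (B.continuous.tendsto T).comp h2
  exact tendsto_nhds_unique h3 (h4.congr fun n => (hAB n).symm)

end QuasiLocal

/-! ### Limits of eventually constant contractions -/

section Limit

variable {G F : Type*} [NormedAddCommGroup G] [NormedSpace ℂ G] [NormedAddCommGroup F]
  [NormedSpace ℂ F]

theorem eventually_const_of_mem_span {Φ : ℕ → G →L[ℂ] F} {s : Set G}
    (hs : ∀ T ∈ s, ∃ m, ∀ n, m ≤ n → Φ n T = Φ m T) {T : G} (hT : T ∈ Submodule.span ℂ s) :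
    ∃ m, ∀ n, m ≤ n → Φ n T = Φ m T := by
  induction hT using Submodule.span_induction with
  | mem T hT => exact hs T hT
  | zero => exact ⟨0, fun n _ => by rw [map_zero, map_zero]⟩
  | add S T _ _ hS hT =>
    obtain ⟨m, hm⟩ := hS
    obtain ⟨m', hm'⟩ := hT
    refine ⟨max m m', fun n hn => ?_⟩
    rw [map_add, map_add, hm n ((le_max_left _ _).trans hn), hm' n ((le_max_right _ _).trans hn),
      hm _ (le_max_left _ _), hm' _ (le_max_right _ _)]
  | smul c T _ hT =>
    obtain ⟨m, hm⟩ := hT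
    exact ⟨m, fun n hn => by rw [map_smul, map_smul, hm n hn]⟩

/-- A sequence of contractions that is eventually constant on each element of a set converges
pointwise on the closure of the span of the set. -/
theorem exists_tendsto_of_mem_closure_span [CompleteSpace F] {Φ : ℕ → G →L[ℂ] F}
    (hΦ : ∀ n T, ‖Φ n T‖ ≤ ‖T‖) {s : Set G} (hs : ∀ T ∈ s, ∃ m, ∀ n, m ≤ n → Φ n T = Φ m T)
    {T : G} (hT : T ∈ closure (Submodule.span ℂ s : Set G)) :
    ∃ y, Tendsto (fun n => Φ n T) atTop (𝓝 y) := by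
  refine cauchySeq_tendsto_of_complete (Metric.cauchySeq_iff'.2 fun ε hε => ?_)
  obtain ⟨S, hS, hST⟩ := Metric.mem_closure_iff.1 hT (ε / 2) (by positivity)
  obtain ⟨m, hm⟩ := eventually_const_of_mem_span hs hS
  refine ⟨m, fun n hn => ?_⟩
  rw [dist_eq_norm] at hST ⊢
  have h3 : Φ n T - Φ m T = Φ n (T - S) - Φ m (T - S) := by
    rw [map_sub, map_sub, hm n hn]; abel
  rw [h3]
  refine (norm_sub_le _ _).trans_lt ?_
  have h4 := hΦ n (T - S)
  have h5 := hΦ m (T - S)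
  linarith

theorem exists_limit [CompleteSpace F] {Q : Type*} [NormedAddCommGroup Q] [NormedSpace ℂ Q]
    {Φ : ℕ → G →L[ℂ] F} (hΦ : ∀ n T, ‖Φ n T‖ ≤ ‖T‖) {s : Set G}
    (hs : ∀ T ∈ s, ∃ m, ∀ n, m ≤ n → Φ n T = Φ m T) (ι : Q →ₗᵢ[ℂ] G)
    (hι : ∀ T, ι T ∈ closure (Submodule.span ℂ s : Set G)) :
    ∃ E : Q →L[ℂ] F, ∀ T, Tendsto (fun n => Φ n (ι T)) atTop (𝓝 (E T)) := by
  choose E hE using fun T => exists_tendsto_of_mem_closure_span hΦ hs (hι T)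
  refine ⟨LinearMap.mkContinuous
    { toFun := E
      map_add' := fun S T => tendsto_nhds_unique (hE (S + T)) <|
        ((hE S).add (hE T)).congr fun n => by rw [map_add, map_add]
      map_smul' := fun c T => tendsto_nhds_unique (hE (c • T)) <|
        ((hE T).const_smul c).congr fun n => by rw [map_smul, map_smul] } 1 fun T => ?_, hE⟩
  rw [one_mul, ← ι.norm_map]
  exact le_of_tendsto (hE T).norm (Eventually.of_forall fun n => hΦ n (ι T))

theorem tendsto_eq_of_eventually_const {f : ℕ → F} {y z : F} (hf : Tendsto f atTop (𝓝 y)) {m : ℕ}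
    (h : ∀ n, m ≤ n → f n = z) : y = z :=
  tendsto_nhds_unique hf (tendsto_atTop_of_eventually_const h)

theorem isPositive_of_tendsto {G : Type*} [NormedAddCommGroup G] [InnerProductSpace ℂ G]
    [CompleteSpace G] {f : ℕ → Op G} {S : Op G} (hf : Tendsto f atTop (𝓝 S))
    (h : ∀ n, (f n).IsPositive) : S.IsPositive :=
  isPositive_of_inner_nonneg fun x => by
    have h2 : Continuous fun S : Op G => ⟪x, S x⟫_ℂ := by fun_prop
    exact ge_of_tendsto ((h2.tendsto _).comp hf)
      (Eventually.of_forall fun n => inner_nonneg_of_isPositive (h n) x)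

end Limit

/-! ### Extension to the quasi-local algebra -/

section QuasiLocal

variable {𝓗 : Type*} [NormedAddCommGroup 𝓗] [InnerProductSpace ℂ 𝓗] [CompleteSpace 𝓗] {k : ℕ}

variable (𝓗 k) in
/-- The inclusion of the quasi-local algebra. -/
def quasiLocalIncl : quasiLocal 𝓗 (Vertex k) →ₗᵢ[ℂ] Op (HTensor 𝓗 (Vertex k)) where
  toFun := Subtype.val
  map_add' _ _ := rfl
  map_smul' _ _ := rfl
  norm_map' _ := rfl

theorem exists_quasiLocal_limit {F : Type*} [NormedAddCommGroup F] [NormedSpace ℂ F]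
    [CompleteSpace F] {Φ : ℕ → Op (HTensor 𝓗 (Vertex k)) →L[ℂ] F}
    (hΦ : ∀ n T, ‖Φ n T‖ ≤ ‖T‖) {L : ℕ → (Vertex k → Op 𝓗) → F}
    (hc : ∀ m n (a : Vertex k → Op 𝓗), m ≤ n → Φ n (productOp (ball k m) a) = L m a) :
    ∃ E : quasiLocal 𝓗 (Vertex k) →L[ℂ] F,
      (∀ m a, E (productElt (ball k m) a) = L m a) ∧
      ∀ T, Tendsto (fun n => Φ n (quasiLocalIncl 𝓗 k T)) atTop (𝓝 (E T)) := by
  obtain ⟨E, hE⟩ := exists_limit (s := {T | ∃ (n : ℕ) (a : Vertex k → Op 𝓗),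
      T = productOp (ball k n) a}) hΦ
    (fun T hT => by
      obtain ⟨m, a, rfl⟩ := hT
      exact ⟨m, fun n hn => (hc m n a hn).trans (hc m m a le_rfl).symm⟩)
    (quasiLocalIncl 𝓗 k) mem_closure_localSpan
  exact ⟨E, fun m a => tendsto_eq_of_eventually_const (hE _) (hc m · a), hE⟩

/-- There is a positive bounded map on the quasi-local algebra with the values `L n a` on the
local product elements. -/
abbrev HasRootMap (L : ℕ → (Vertex k → Op 𝓗) → Op 𝓗) : Prop :=
  ∃ E : quasiLocal 𝓗 (Vertex k) →L[ℂ] Op 𝓗, (∀ n a, E (productElt (ball k n) a) = L n a) ∧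
    ∀ T, (quasiLocalIncl 𝓗 k T).IsPositive → (E T).IsPositive

/-- The compatibility of L with padding makes the volume maps stationary on each local product; the
limit inherits positivity. -/
theorem hasRootMap_of_hasVolumeMap {L : ℕ → (Vertex k → Op 𝓗) → Op 𝓗}
    (h : ∀ n, HasVolumeMap n (L n)) (hL : ∀ m n a, m ≤ n → L n (pad m a) = L m a) :
    HasRootMap L := by
  choose Φ hΦ hΦa using h
  obtain ⟨E, hE, hE'⟩ := exists_quasiLocal_limit (fun n => (hΦ n).norm_le)
    fun m n (a : Vertex k → Op 𝓗) hmn =>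
      ((congrArg (Φ n) (productOp_ball_pad hmn a).symm).trans (hΦa n _)).trans (hL m n a hmn)
  exact ⟨E, hE, fun T hT => isPositive_of_tendsto (hE' T) fun n => (hΦ n).pos _ hT⟩

end QuasiLocal

/-! ### Density operators and the root expansion -/

section Chain

theorem exists_traceFunctional {G : Type*} [NormedAddCommGroup G] [InnerProductSpace ℂ G]
    [CompleteSpace G] {ω : Op G} (hω : IsPosTraceClass ω) :
    ∃ (τ : Op G →L[ℂ] ℂ) (w : basisSet G → G), (∀ T, τ T = trace (ω * T)) ∧
      HasSum (fun s => ‖w s‖ ^ 2) (trace ω).re ∧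
      ∀ T, HasSum (fun s => ⟪w s, T (w s)⟫_ℂ) (trace (ω * T)) := by
  have hw : ∀ T : Op G, HasSum (fun s => ⟪CFC.sqrt ω (stdBasis G s),
      T (CFC.sqrt ω (stdBasis G s))⟫_ℂ) (trace (ω * T)) := fun T => by
    have h := hω.isHS_sqrt.hasSum_trace_mul T
    have h2 : CFC.sqrt ω ∘L (CFC.sqrt ω).adjoint = ω := by
      rw [adjoint_sqrt]
      exact hω.sqrt_mul_sqrt
    rwa [h2] at h
  refine ⟨LinearMap.mkContinuous
    { toFun := fun T => trace (ω * T)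
      map_add' := fun S T => by
        exact (hw (S + T)).unique (hasSum_of_eq (fun s => by rw [← inner_add_right]; rfl)
          ((hw S).add (hw T)))
      map_smul' := fun c T => by
        refine (hw (c • T)).unique (hasSum_of_eq (fun s => ?_) ((hw T).mul_left c))
        rw [← inner_smul_right]; rfl } (trace ω).re fun T => ?_, _, fun T => rfl,
    hω.hasSum_sqrt, hw⟩
  change ‖trace (ω * T)‖ ≤ _
  rw [← (hw T).tsum_eq, mul_comm]
  refine tsum_of_norm_bounded (hω.hasSum_sqrt.mul_left ‖T‖) fun s => ?_
  refine (norm_inner_le_norm _ _).trans ?_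
  have := T.le_opNorm (CFC.sqrt ω (stdBasis G s))
  nlinarith [norm_nonneg (CFC.sqrt ω (stdBasis G s))]

variable {H K Λ : Type*} [NormedAddCommGroup H] [InnerProductSpace ℂ H] [CompleteSpace H]
  [NormedAddCommGroup K] [InnerProductSpace ℂ K]

namespace OQRW

variable (W : OQRW H Λ) (e : HilbertBasis Λ ℂ K) {k : ℕ}

/-- The quadratic forms agree by ∑ ‖M_j^i x‖² = ‖x‖², and on a complex space they determine the
operator. -/
theorem weighted_one : W.weighted e (fun _ => 1) 1 = 1 := by
  have h : ∀ x, ⟪x, W.weighted e (fun _ => 1) 1 x⟫_ℂ = ⟪x, x⟫_ℂ := fun x => by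
    have h1 := (W.hasSum_weighted e (c := fun _ => 1) (C := 1) (fun _ => by simp) 1 x).mapL
      (innerSL ℂ x)
    refine h1.unique ?_
    rw [inner_self_eq_norm_sq_to_K]
    refine hasSum_congr_of_eq (fun p => ?_) (by norm_cast)
      (Complex.hasSum_ofReal.2 (W.hasSum_norm_sq_M e x))
    rw [innerSL_apply_apply, one_smul, ContinuousLinearMap.adjoint_inner_right, one_apply_eq_self,
      inner_self_eq_norm_sq_to_K]
    norm_cast
  refine ContinuousLinearMap.coe_injective ((ext_inner_map _ _).1 fun x => ?_)
  have h2 := congrArg (starRingEnd ℂ) (h x)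
  rwa [inner_conj_symm, inner_conj_symm] at h2

theorem norm_inner_calM_le (j : Λ) (a : Op (HK H K)) (x : HK H K) :
    ‖⟪x, W.calM e j a x⟫_ℂ‖ ≤ ‖a‖ * ‖(emb H e j).adjoint x‖ ^ 2 := by
  have h1 := (W.hasSum_calM e j a x).mapL (innerSL ℂ x)
  simp only [innerSL_apply_apply] at h1
  rw [← h1.tsum_eq]
  refine tsum_of_norm_bounded ((W.hasSum_norm_sq_M_right e j x).mul_left ‖a‖) fun i => ?_
  rw [mul_apply_eq_comp, mul_apply_eq_comp, ContinuousLinearMap.adjoint_inner_right]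
  refine (norm_inner_le_norm _ _).trans ?_
  have := a.le_opNorm (W.M e i j x)
  nlinarith [norm_nonneg (W.M e i j x)]

/-- The series over j converges only strongly, so the trace cannot be taken termwise by continuity.
Decomposing ω into vectors w_s gives a double family dominated by the squared block components of
the w_s, whose total is Tr ω. -/
theorem hasSum_trace_weighted {ω : Op (HK H K)} (hω : IsPosTraceClass ω) {c : Λ → ℂ} {C : ℝ}
    (hc : ∀ j, ‖c j‖ ≤ C) (a : Op (HK H K)) :
    HasSum (fun j => trace (ω * W.calM e j a) * c j) (trace (ω * W.weighted e c a)) := by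
  obtain ⟨-, w, -, hw, hωT⟩ := exists_traceFunctional hω
  let F : Λ × basisSet (HK H K) → ℂ := fun p => ⟪w p.2, W.calM e p.1 a (w p.2)⟫_ℂ * c p.1
  have hs : Summable F := by
    have h1 : HasSum (fun q : basisSet (HK H K) × Λ => ‖(emb H e q.2).adjoint (w q.1)‖ ^ 2)
        (trace ω).re :=
      hasSum_prod_of_nonneg (fun _ => by positivity)
        (fun s => hasSum_norm_sq_adjoint_emb e (w s)) hw
    have h2 := (Equiv.prodComm Λ (basisSet (HK H K))).hasSum_iff.2 h1
    refine Summable.of_norm_bounded (h2.summable.mul_left (‖a‖ * C)) fun p => ?_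
    rw [norm_mul, mul_right_comm]
    exact mul_le_mul (W.norm_inner_calM_le e p.1 a (w p.2)) (hc _) (norm_nonneg _)
      (mul_nonneg (norm_nonneg _) (sq_nonneg _))
  have h1 := hs.hasSum.prod_fiberwise fun j => (hωT (W.calM e j a)).mul_right (c j)
  have h2 : HasSum (fun s => ⟪w s, W.weighted e c a (w s)⟫_ℂ) (∑' p, F p) := by
    refine ((Equiv.prodComm _ _).hasSum_iff.2 hs.hasSum).prod_fiberwise fun s => ?_
    have h3 := (W.hasSum_weighted_calM e hc a (w s)).mapL (innerSL ℂ (w s))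
    refine hasSum_of_eq (fun j => ?_) h3
    rw [innerSL_apply_apply, inner_smul_right, mul_comm]
    rfl
  rwa [← (hωT _).unique h2] at h1

/-- The conditional expectation onto the root exists. -/
theorem hasRootMap : HasRootMap fun n (a : Vertex k → Op (HK H K)) =>
    W.weighted e (fun j => ∏ u ∈ annulus k n, W.ψ e j (a u)) (a []) :=
  hasRootMap_of_hasVolumeMap (W.exists_finiteVolumeExp e k) fun m _ a hmn =>
    congrArg₂ (W.weighted e) (funext fun j => W.prod_ψ_pad e hmn a j)
      (if_pos (Nat.zero_le m) : pad m a [] = a [])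

end OQRW

end Chain

/-! ### Existence and uniqueness of the quantum Markov chain -/

section MarkovChain

variable {𝓗 : Type*} [NormedAddCommGroup 𝓗] [InnerProductSpace ℂ 𝓗] [CompleteSpace 𝓗] {k : ℕ}

theorem productElt_one (F : Finset (Vertex k)) :
    productElt F (fun _ => (1 : Op 𝓗)) = (1 : quasiLocal 𝓗 (Vertex k)) :=
  Subtype.ext (productOp_one F)

theorem isPositive_star_mul (T : quasiLocal 𝓗 (Vertex k)) :
    (quasiLocalIncl 𝓗 k (star T * T)).IsPositive :=
  ContinuousLinearMap.isPositive_adjoint_comp_self (T : Op (HTensor 𝓗 (Vertex k)))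

/-- Root expectations are unique. -/
theorem IsRootExpectation.unique {𝓔 : Op 𝓗 → (Fin k → Op 𝓗) → Op 𝓗}
    {E E' : quasiLocal 𝓗 (Vertex k) →L[ℂ] Op 𝓗} (h : IsRootExpectation 𝓔 E)
    (h' : IsRootExpectation 𝓔 E') : E = E' :=
  quasiLocal_ext fun n a => (h n a).trans (h' n a).symm

/-- The quantum Markov chain with a given initial state is unique. -/
theorem IsQMC.unique {φ₀ : Op 𝓗 → ℂ} {𝓔 : Op 𝓗 → (Fin k → Op 𝓗) → Op 𝓗}
    {φ φ' : quasiLocal 𝓗 (Vertex k) →L[ℂ] ℂ} (h : IsQMC φ₀ 𝓔 φ) (h' : IsQMC φ₀ 𝓔 φ') : φ = φ' :=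
  quasiLocal_ext fun n a => tendsto_nhds_unique (h.tendsto n a) (h'.tendsto n a)

theorem exists_isQMC {𝓔 : Op 𝓗 → (Fin k → Op 𝓗) → Op 𝓗}
    {E : quasiLocal 𝓗 (Vertex k) →L[ℂ] Op 𝓗}
    (hit : ∀ m n a, m ≤ n → iterExp 𝓔 n (pad m a) = E (productElt (ball k m) a))
    (h1 : E 1 = 1) (hpos : ∀ T, (quasiLocalIncl 𝓗 k T).IsPositive → (E T).IsPositive)
    {ω : Op 𝓗} (hω : IsDensity ω) :
    ∃ φ : quasiLocal 𝓗 (Vertex k) →L[ℂ] ℂ, IsQMC (fun a => trace (ω * a)) 𝓔 φ ∧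
      ∀ T, φ T = trace (ω * E T) := by
  obtain ⟨τ, w, hτ, -, hw⟩ := exists_traceFunctional hω.posTraceClass
  refine ⟨τ ∘L E, ⟨⟨?_, fun T => ?_⟩, fun m a => ?_⟩, fun T => hτ (E T)⟩
  · change τ (E 1) = 1
    rw [h1, hτ, mul_one, hω.trace_eq_one]
  · change 0 ≤ τ (E (star T * T))
    rw [hτ]
    exact (hw _).nonneg fun s =>
      inner_nonneg_of_isPositive (hpos _ (isPositive_star_mul T)) (w s)
  · change Tendsto _ _ (𝓝 (τ (E (productElt (ball k m) a))))
    rw [hτ]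
    -- Beyond the volume of a the iteration only meets identities, so the sequence is constant from
    -- n = m on.
    exact tendsto_atTop_of_eventually_const (i₀ := m) fun n hn =>
      congrArg (fun b => trace (ω * b)) (hit m n a hn)

/-- The existence and uniqueness of the root expectation and of the quantum Markov chains, from an
expansion `L` of the iterated transition expectations. -/
theorem exists_rootExpectation_and_isQMC {𝓔 : Op 𝓗 → (Fin k → Op 𝓗) → Op 𝓗}
    {L : ℕ → (Vertex k → Op 𝓗) → Op 𝓗}
    (hE : HasRootMap L)
    (hit : ∀ m n a, m ≤ n → iterExp 𝓔 n (pad m a) = L m a) (h1 : L 0 (fun _ => 1) = 1)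
    {J : Type*} {c : ℕ → (Vertex k → Op 𝓗) → J → ℂ} {S : J → Op 𝓗 → Op 𝓗}
    (hS : ∀ n a x, HasSum (fun j => c n a j • S j (a []) x) (L n a x))
    (hω : ∀ ω : Op 𝓗, IsDensity ω → ∀ n a,
      HasSum (fun j => trace (ω * S j (a [])) * c n a j) (trace (ω * L n a))) :
    ∃ E : quasiLocal 𝓗 (Vertex k) →L[ℂ] Op 𝓗, IsRootExpectation 𝓔 E ∧
      (∀ E', IsRootExpectation 𝓔 E' → E' = E) ∧
      (∀ (n : ℕ) (a : Vertex k → Op 𝓗) (x : 𝓗),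
        HasSum (fun j => c n a j • S j (a []) x) (E (productElt (ball k n) a) x)) ∧
      ∀ ω : Op 𝓗, IsDensity ω →
        ∃ φ : quasiLocal 𝓗 (Vertex k) →L[ℂ] ℂ,
          IsQMC (fun a => trace (ω * a)) 𝓔 φ ∧
          (∀ φ', IsQMC (fun a => trace (ω * a)) 𝓔 φ' → φ' = φ) ∧
          (∀ a, φ a = trace (ω * E a)) ∧
          ∀ (n : ℕ) (a : Vertex k → Op 𝓗),
            HasSum (fun j => trace (ω * S j (a [])) * c n a j) (φ (productElt (ball k n) a)) := by
  obtain ⟨E, hE, hpos⟩ := hE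
  have hit' : ∀ m n a, m ≤ n → iterExp 𝓔 n (pad m a) = E (productElt (ball k m) a) :=
    fun m n a hmn => (hit m n a hmn).trans (hE m a).symm
  have hroot : IsRootExpectation 𝓔 E := fun n a => (hit' n n a le_rfl).symm
  have hE1 : E 1 = 1 := by rw [← productElt_one (ball k 0), hE, h1]
  refine ⟨E, hroot, fun E' hE' => hE'.unique hroot, fun n a x => ?_, fun ω hd => ?_⟩
  · rw [hE]
    exact hS n a x
  · obtain ⟨φ, hφ, hφE⟩ := exists_isQMC hit' hE1 hpos hd
    refine ⟨φ, hφ, fun φ' hφ' => hφ'.unique hφ, hφE, fun n a => ?_⟩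
    rw [hφE, hE]
    exact hω ω hd n a

end MarkovChain

end TreeOQRW

end

theorem mainTheorem4 {H K Λ : Type*}
    [NormedAddCommGroup H] [InnerProductSpace ℂ H] [CompleteSpace H]
    [TopologicalSpace.SeparableSpace H]
    [NormedAddCommGroup K] [InnerProductSpace ℂ K] [CompleteSpace K]
    [TopologicalSpace.SeparableSpace K]
    (e : HilbertBasis Λ ℂ K) (W : OQRW H Λ) (k : ℕ) (hk : 1 ≤ k)
    (𝓔 : Op (HK H K) → (Fin k → Op (HK H K)) →
      Op (HK H K))
    (h𝓔 : 𝓔 = W.prodTransitionExp e k ∨ 𝓔 = W.diagTransitionExp e k) :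
    (∀ j a x, HasSum (fun i => ((W.M e i j).adjoint * a * W.M e i j) x) (W.calM e j a x)) ∧
    (∀ j (b : Op (HK H K)), Summable fun i => trace
      (opTensor (W.B i j * W.ρ j * (W.B i j).adjoint)
        (OQRW.ketBra e i i) * b)) ∧
    ∃ E : quasiLocal (HK H K) (Vertex k) →L[ℂ]
        Op (HK H K),
      IsRootExpectation 𝓔 E ∧
      (∀ E', IsRootExpectation 𝓔 E' → E' = E) ∧
      (∀ (n : ℕ) (a : Vertex k → Op (HK H K))
          (x : HK H K),
        HasSum (fun j => (∏ u ∈ annulus k n, W.ψ e j (a u)) • W.calM e j (a []) x)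
          (E (productElt (ball k n) a) x)) ∧
      ∀ ω : Op (HK H K), IsDensity ω →
        ∃ φ : quasiLocal (HK H K) (Vertex k) →L[ℂ] ℂ,
          IsQMC (fun a => trace (ω * a)) 𝓔 φ ∧
          (∀ φ', IsQMC (fun a => trace (ω * a)) 𝓔 φ' → φ' = φ) ∧
          (∀ a, φ a = trace (ω * E a)) ∧
          ∀ (n : ℕ) (a : Vertex k → Op (HK H K)),
            HasSum (fun j => trace (ω * W.calM e j (a [])) *
                ∏ u ∈ annulus k n, W.ψ e j (a u))
              (φ (productElt (ball k n) a)) := by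
  refine ⟨W.hasSum_calM e, W.summable_trace_B e, ?_⟩
  have h := W.isTransition_of_eq e hk h𝓔
  refine exists_rootExpectation_and_isQMC
    (c := fun n a j => ∏ u ∈ annulus k n, W.ψ e j (a u)) (S := W.calM e)
    (W.hasRootMap e) (fun m n a hmn => W.iterExp_pad e h hmn a) ?_
    (fun n a => W.hasSum_weighted_calM e (W.norm_prod_ψ_le e _ a) _)
    (fun ω hω n a => W.hasSum_trace_weighted e hω.posTraceClass (W.norm_prod_ψ_le e _ a) _)
  -- Normalisation: at the identity all weights are products of ψ_j(1) = 1, and ∑_j 𝓜_j(1) = 1.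
  exact (congrArg (fun c => W.weighted e c 1) (funext fun j =>
    Finset.prod_eq_one fun _ _ => W.ψ_one e j)).trans (W.weighted_one e)
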